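/- Setting. For $k\in\{1,2\}$ let $\mathcal E^{(k)},\mathcal S^{(k)}$ be disjoint finite sets, $A^{(k)}_{\mathcal E\mathcal E}$, $A^{(k)}_{\mathcal S\mathcal S}$ conservative intensity matrices on them, $r^{(k)}:\mathcal E^{(k)}\to\mathbb R\setminus\{0\}$, $\rho^{(k)}:\mathcal S^{(k)}\to\mathbb R\setminus\{0\}$ reward functions, $P^{(k)}$ a transition matrix from $\mathcal E^{(k)}$ to $\mathcal S^{(k)}$, $i^{(k)}\in\mathcal E^{(k)}$ with $r^{(k)}(i^{(k)})>0$, and $\gamma_0>0$ a constant that is at least the modulus of every diagonal entry of these intensity matrices. Let $0=\theta^{(k)}_0<\theta^{(k)}_1<\cdots$ ($k=1,2$) be the arrival times of two independent Poisson processes $\Theta^{(k)}$ of intensity $\gamma_0$, let $J^{(k)}$ be a process with $J^{(k)}(0)=i^{(k)}$, and let $F^{(k)}(t)=\int_0^t (r^{(k)}\mathbf 1_{\mathcal E^{(k)}}+\rho^{(k)}\mathbf 1_{\mathcal S^{(k)}})(J^{(k)}(s))\,ds$ and $$\tau^{[1]}=\inf\{s>0:F^{(1)}(s)=0\text{ or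 }F^{(2)}(s)=0\},\qquad \tau^{[2]}=\inf\{s>0:F^{(1)}(s_1)=0\text{ and }F^{(2)}(s_2)=0\text{ for some }s_1,s_2\in(0,s]\}.$$ The process is such that $J^{(k)}(t)\in\mathcal E^{(k)}$ for $t<\tau^{[1]}$ and $J^{(k)}(t)\in\mathcal S^{(k)}$ for $t\ge\tau^{[1]}$; $J^{(k)}$ is right-continuous and piecewise constant and jumps only at points of $\Theta^{(k)}$ and at $\tau^{[1]}$; at a point of $\Theta^{(k)}$, given $\Theta^{(1)},\Theta^{(2)}$ and the strict past of $J^{(1)},J^{(2)}$, it jumps according to $I+A^{(k)}_{\mathcal E\mathcal E}/\gamma_0$ before $\tau^{[1]}$ and to $I+A^{(k)}_{\mathcal S\mathcal S}/\gamma_0$ after $\tau^{[1]}$; and at $\tau^{[1]}<\infty$, given $\Theta^{(1)},\Theta^{(2)}$ and the strict past of $J^{(1)},J^{(2)}$, the two environments jump independently according to $P^{(1)}$ and $P^{(2)}$. On $\{\tau^{[1]}<\infty\}$ the superscript $[1]$ denotes the component whose level is $0$ at $\tau^{[1]}$ (it is almost surely unique), and $[2]$ the other one. For each $\gamma>\gamma_0$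 let $\widehat\Theta^{(1)},\widehat\Theta^{(2)}$ be Poisson processes of intensity $\gamma-\gamma_0$, independent of each other and of $(\Theta^{(1)},\Theta^{(2)},J^{(1)},J^{(2)})$, and let $\widetilde\theta^{(k)}_1<\widetilde\theta^{(k)}_2<\cdots$ be the points of the superposition of $\Theta^{(k)}$ and $\widehat\Theta^{(k)}$. On $\{\tau^{[1]}<\infty\}$ put $$\ell_*=\inf\{\ell\ge1:\tau^{[1]}<\widetilde\theta^{[1]}_\ell\},\qquad \sigma^{[k]}_*=\widetilde\theta^{[k]}_{\ell_*},$$ and let $\ell^{[k]}$ be the index with $\tau^{[1]}\in[\theta^{[k]}_{\ell^{[k]}},\theta^{[k]}_{\ell^{[k]}+1})$. Let $(\sigma^{[1]},\sigma^{[2]})=(\sigma^{[1]}_*,\sigma^{[2]}_*)$ if $\sigma^{[k]}_*\in[\theta^{[k]}_{\ell^{[k]}},\theta^{[k]}_{\ell^{[k]}+1})$ for both $k=1,2$, and $(\sigma^{[1]},\sigma^{[2]})=(\tau^{[1]},\tau^{[1]})$ otherwise. Let $\widetilde J^{[k]}(t)$ be $J^{[k]}(t)$ for $t<\min(\tau^{[1]},\sigma^{[k]})$;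 the left limit $J^{[k]}(\min(\tau^{[1]},\sigma^{[k]})-)$ for $\min(\tau^{[1]},\sigma^{[k]})\le t<\sigma^{[k]}$; $J^{[k]}(\tau^{[1]})$ for $\sigma^{[k]}\le t<\theta^{[k]}_{\ell^{[k]}+1}$; and $J^{[k]}(t)$ for $t\ge\theta^{[k]}_{\ell^{[k]}+1}$. Let $\widetilde F^{[k]}(t)=\int_0^t (r^{[k]}\mathbf 1_{\mathcal E^{[k]}}+\rho^{[k]}\mathbf 1_{\mathcal S^{[k]}})(\widetilde J^{[k]}(s))\,ds$. Finally let $$\widetilde\tau^{[1]}=\sigma^{[1]},\qquad n_*=\inf\{n\ge1:\widetilde F^{[2]}(\widetilde\theta^{[2]}_n)<0\},\qquad \widetilde\tau^{[2]}=\widetilde\theta^{[2]}_{n_*},$$ where $\inf\emptyset=\infty$ and $\widetilde\theta^{[2]}_\infty=\infty$. Theorem. On $\{\tau^{[1]}<\infty,\ \tau^{[2]}<\infty\}$, the bivariate vectors $(\widetilde\tau^{[1]},\widetilde\tau^{[2]})$ and $(\ell_*/\gamma,\,n_*/\gamma)$ both converge in probability to $(\tau^{[1]},\tau^{[2]})$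 as $\gamma\to\infty$. That is, for every $\varepsilon>0$, the probability that $\tau^{[1]},\tau^{[2]}<\infty$ and that the vector in question is at distance at least $\varepsilon$ from $(\tau^{[1]},\tau^{[2]})$ tends to $0$ as $\gamma\to\infty$. -/

import Mathlib

open MeasureTheory ProbabilityTheory Filter Topology
open scoped ENNReal

noncomputable section

namespace RuinFluid

/-! ### General notions -/

/-- The left limit of a function with values in a discrete space
(the value of `f` itself if the left limit does not exist). -/
def leftValue {X : Type*} (f : ℝ → X) (t : ℝ) : X :=
  open Classical in
  if h : ∃ x, ∀ᶠ s in 𝓝[<] t, f s = x then h.choose else f t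

/-- The infimum of a set of times, in `[0, ∞]`; it is `∞` for the empty set. -/
def infTime (A : Set ℝ) : ℝ≥0∞ := ⨅ s ∈ A, ENNReal.ofReal s

/-- The infimum of the indices `n ≥ 1` with property `p`; it is `∞` if there are none. -/
def firstIndex (p : ℕ → Prop) : ℕ∞ := ⨅ n ∈ {n : ℕ | 1 ≤ n ∧ p n}, (n : ℕ∞)

/-- The time of the arrival with a given, possibly infinite, index. -/
def arrivalTime (g : ℕ → ℝ) : ℕ∞ → ℝ≥0∞
  | none => ⊤
  | some n => ENNReal.ofReal (g n)

/-- The number of arrivals in `(0, t]` of a point process with arrival times `g 1, g 2, …`. -/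
def countArrivals (g : ℕ → ℝ) (t : ℝ) : ℕ∞ := {m : ℕ | 1 ≤ m ∧ g m ≤ t}.encard

/-- The arrival times of the superposition of two point processes: the `n`-th one is the first
time at which both processes together have had `n` arrivals (and it is `0` for `n = 0`). -/
def superpose (a b : ℕ → ℝ) (n : ℕ) : ℝ :=
  sInf {t : ℝ | 0 ≤ t ∧ (n : ℕ∞) ≤ countArrivals a t + countArrivals b t}

/-- `θ 1 < θ 2 < …` are the arrival times of a Poisson process of intensity `c` on `(0, ∞)`, and
`θ 0 = 0`: the interarrival times are independent with the exponential law of parameter `c`. -/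
structure IsPoissonArrivals {Ω : Type*} [MeasurableSpace Ω] (P : Measure Ω) (c : ℝ)
    (θ : ℕ → Ω → ℝ) : Prop where
  measurable : ∀ n, Measurable (θ n)
  zero : ∀ ω, θ 0 ω = 0
  law : ∀ n, HasLaw (fun ω => θ (n + 1) ω - θ n ω) (expMeasure c) P
  indep : iIndepFun (fun (n : ℕ) (ω : Ω) => θ (n + 1) ω - θ n ω) P

/-- Convergence in probability, on an event `A`, of a family of pairs of `[0, ∞]`-valued random
variables: for every `ε > 0`, the probability that `A` occurs and that `x c` and `y` are at
distance at least `ε` tends to `0` as `c → ∞`. (A value `∞` is at infinite distance from every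
finite one.) -/
def TendstoInProbOn {Ω : Type*} [MeasurableSpace Ω] (P : Measure Ω) (A : Set Ω)
    (x : ℝ → Ω → ℝ≥0∞ × ℝ≥0∞) (y : Ω → ℝ≥0∞ × ℝ≥0∞) : Prop :=
  ∀ ε : ℝ≥0∞, 0 < ε →
    Tendsto (fun c : ℝ => P {ω | ω ∈ A ∧
      ε ≤ max (edist (x c ω).1 (y ω).1) (edist (x c ω).2 (y ω).2)}) atTop (𝓝 0)

/-! ### The parameters of the model -/

/-- The parameters of a ruin-dependent bivariate stochastic fluid process. The two components are
indexed by `Fin 2`; component `k` has environments `E k` before and `S k` after the switch. -/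
structure Params (E S : Fin 2 → Type*) [∀ k, Fintype (E k)] [∀ k, Fintype (S k)] where
  /-- intensity matrices before the switch -/
  AE : ∀ k, Matrix (E k) (E k) ℝ
  /-- intensity matrices after the switch -/
  AS : ∀ k, Matrix (S k) (S k) ℝ
  /-- reward functions before the switch -/
  r : ∀ k, E k → ℝ
  /-- reward functions after the switch -/
  ρ : ∀ k, S k → ℝ
  /-- transition matrices of the environments at the switch -/
  Q : ∀ k, Matrix (E k) (S k) ℝ
  /-- initial environments -/
  init : ∀ k, E k
  /-- uniformization intensity -/
  γ₀ : ℝ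
  AE_nonneg : ∀ k i j, i ≠ j → 0 ≤ AE k i j
  AE_sum : ∀ k i, ∑ j, AE k i j = 0
  AS_nonneg : ∀ k i j, i ≠ j → 0 ≤ AS k i j
  AS_sum : ∀ k i, ∑ j, AS k i j = 0
  r_ne : ∀ k i, r k i ≠ 0
  ρ_ne : ∀ k i, ρ k i ≠ 0
  Q_nonneg : ∀ k i j, 0 ≤ Q k i j
  Q_sum : ∀ k i, ∑ j, Q k i j = 1
  init_pos : ∀ k, 0 < r k (init k)
  γ₀_pos : 0 < γ₀
  AE_le : ∀ k i, |AE k i i| ≤ γ₀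
  AS_le : ∀ k i, |AS k i i| ≤ γ₀

section Model

variable {E S : Fin 2 → Type*} [∀ k, Fintype (E k)] [∀ k, Fintype (S k)]
  [∀ k, DecidableEq (E k)] [∀ k, DecidableEq (S k)] (M : Params E S)

/-- The rate of change of level `k` in a given environment. -/
def Params.rate (k : Fin 2) : E k ⊕ S k → ℝ := Sum.elim (M.r k) (M.ρ k)

/-- Transition probabilities of environment `k` at the arrivals of its own Poisson process:
`1 + A / γ₀`, with `A` the intensity matrix in force. -/
def Params.jumpProb (k : Fin 2) : E k ⊕ S k → E k ⊕ S k → ℝ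
  | .inl i, .inl j => (1 + M.γ₀⁻¹ • M.AE k) i j
  | .inr i, .inr j => (1 + M.γ₀⁻¹ • M.AS k) i j
  | _, _ => 0

/-- Transition probabilities of environment `k` at the first ruin time. -/
def Params.switchProb (k : Fin 2) : E k ⊕ S k → S k → ℝ
  | .inl i, j => M.Q k i j
  | .inr _, _ => 0

/-! ### Functionals of a pair of environment paths `J` -/

/-- The level of component `k` at time `t`. -/
def level (J : ∀ k, ℝ → E k ⊕ S k) (k : Fin 2) (t : ℝ) : ℝ :=
  ∫ s in (0 : ℝ)..t, M.rate k (J k s)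

/-- The first ruin time. -/
def tau1 (J : ∀ k, ℝ → E k ⊕ S k) : ℝ≥0∞ :=
  infTime {s | 0 < s ∧ (level M J 0 s = 0 ∨ level M J 1 s = 0)}

/-- The second ruin time: the time by which both levels have returned to zero. -/
def tau2 (J : ∀ k, ℝ → E k ⊕ S k) : ℝ≥0∞ :=
  infTime {s | 0 < s ∧ ∃ s₁ ∈ Set.Ioc 0 s, ∃ s₂ ∈ Set.Ioc 0 s,
    level M J 0 s₁ = 0 ∧ level M J 1 s₂ = 0}

/-- The component that is ruined first (used only if `tau1` is finite). -/
def first (J : ∀ k, ℝ → E k ⊕ S k) : Fin 2 :=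
  open Classical in if level M J 0 (tau1 M J).toReal = 0 then 0 else 1

/-- The other component. -/
def second (J : ∀ k, ℝ → E k ⊕ S k) : Fin 2 :=
  if first M J = 0 then 1 else 0

/-! ### The compatible pasting on a Poisson grid

Here `θ k` are the arrival times at which environment `k` may jump, and `g k` are those of the
grid. All real-valued quantities below are meant on the event that `tau1` is finite. -/

/-- The index `ℓ` with `tau1 ∈ [θ k ℓ, θ k (ℓ + 1))`. -/
def jumpIndex (J : ∀ k, ℝ → E k ⊕ S k) (θ : Fin 2 → ℕ → ℝ) (k : Fin 2) : ℕ :=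
  sInf {ℓ | θ k ℓ ≤ (tau1 M J).toReal ∧ (tau1 M J).toReal < θ k (ℓ + 1)}

/-- The index of the first point after `tau1` in the grid of the component ruined first. -/
def ellStar (J : ∀ k, ℝ → E k ⊕ S k) (g : Fin 2 → ℕ → ℝ) : ℕ∞ :=
  firstIndex fun ℓ => tau1 M J < ENNReal.ofReal (g (first M J) ℓ)

/-- The candidate switching time of component `k`. -/
def sigmaStar (J : ∀ k, ℝ → E k ⊕ S k) (g : Fin 2 → ℕ → ℝ) (k : Fin 2) : ℝ≥0∞ :=
  arrivalTime (g k) (ellStar M J g)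

/-- The candidate switching times lie between the same arrivals of `θ k` as `tau1` does. -/
def Compatible (J : ∀ k, ℝ → E k ⊕ S k) (θ g : Fin 2 → ℕ → ℝ) : Prop :=
  ∀ k, ENNReal.ofReal (θ k (jumpIndex M J θ k)) ≤ sigmaStar M J g k ∧
    sigmaStar M J g k < ENNReal.ofReal (θ k (jumpIndex M J θ k + 1))

/-- The switching time of component `k` in the compatible pasting. -/
def sigma (J : ∀ k, ℝ → E k ⊕ S k) (θ g : Fin 2 → ℕ → ℝ) (k : Fin 2) : ℝ :=
  open Classical in
  if Compatible M J θ g then (sigmaStar M J g k).toReal else (tau1 M J).toReal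

/-- The environment of component `k` in the compatible pasting. -/
def pastedEnv (J : ∀ k, ℝ → E k ⊕ S k) (θ g : Fin 2 → ℕ → ℝ) (k : Fin 2) (t : ℝ) : E k ⊕ S k :=
  if t < min (tau1 M J).toReal (sigma M J θ g k) then J k t
  else if t < sigma M J θ g k then
    leftValue (J k) (min (tau1 M J).toReal (sigma M J θ g k))
  else if t < θ k (jumpIndex M J θ k + 1) then J k (tau1 M J).toReal
  else J k t

/-- The level of component `k` in the compatible pasting. -/
def pastedLevel (J : ∀ k, ℝ → E k ⊕ S k) (θ g : Fin 2 → ℕ → ℝ) (k : Fin 2) (t : ℝ) : ℝ :=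
  ∫ s in (0 : ℝ)..t, M.rate k (pastedEnv M J θ g k s)

/-- The approximate first ruin time. -/
def approxTau1 (J : ∀ k, ℝ → E k ⊕ S k) (θ g : Fin 2 → ℕ → ℝ) : ℝ≥0∞ :=
  ENNReal.ofReal (sigma M J θ g (first M J))

/-- The first grid index at which the pasted level of the other component is negative. -/
def nStar (J : ∀ k, ℝ → E k ⊕ S k) (θ g : Fin 2 → ℕ → ℝ) : ℕ∞ :=
  firstIndex fun n => pastedLevel M J θ g (second M J) (g (second M J) n) < 0

/-- The approximate second ruin time. -/
def approxTau2 (J : ∀ k, ℝ → E k ⊕ S k) (θ g : Fin 2 → ℕ → ℝ) : ℝ≥0∞ :=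
  arrivalTime (g (second M J)) (nStar M J θ g)

/-! ### The process -/

variable {Ω : Type*} [MeasurableSpace Ω]

/-- The σ-algebra generated by both (whole) sequences of arrival times and by the environments
strictly before the random time `T`. -/
@[reducible] def strictPast (θ : Fin 2 → ℕ → Ω → ℝ) (J : ∀ k, ℝ → Ω → E k ⊕ S k) (T : Ω → ℝ≥0∞) :
    MeasurableSpace Ω :=
  MeasurableSpace.generateFrom
    ({A | ∃ k n t, A = {ω | θ k n ω ≤ t}} ∪
      {A | ∃ k s x, 0 ≤ s ∧ A = {ω | ENNReal.ofReal s < T ω ∧ J k s ω = x}})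

/-- The environments `J` and the Poisson arrival times `θ` of their uniformization form a
ruin-dependent bivariate stochastic fluid process with the given parameters. -/
structure IsRuinFluid (P : Measure Ω) (θ : Fin 2 → ℕ → Ω → ℝ)
    (J : ∀ k, ℝ → Ω → E k ⊕ S k) : Prop where
  poisson : ∀ k, IsPoissonArrivals P M.γ₀ (θ k)
  indep : IndepFun (fun ω n => θ 0 n ω) (fun ω n => θ 1 n ω) P
  measurable : ∀ k t x, 0 ≤ t → MeasurableSet {ω | J k t ω = x}
  init : ∀ k ω, J k 0 ω = .inl (M.init k)
  /-- The environments are in `E k` before, and in `S k` from, the first ruin time on. -/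
  before : ∀ k t ω, 0 ≤ t →
    ((J k t ω).isLeft ↔ ENNReal.ofReal t < tau1 M (fun k s => J k s ω))
  /-- Environment `k` can only jump at the points of `θ k` and at the first ruin time. -/
  const : ∀ k s t ω, 0 ≤ s → s ≤ t → (∀ n, θ k n ω ∉ Set.Ioc s t) →
    ¬ (ENNReal.ofReal s < tau1 M (fun k s => J k s ω) ∧
      tau1 M (fun k s => J k s ω) ≤ ENNReal.ofReal t) → J k s ω = J k t ω
  /-- The jumps at the points of `θ k` follow the uniformized intensity matrices. -/
  jump : ∀ k n x, 1 ≤ n →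
    P[Set.indicator {ω | J k (θ k n ω) ω = x} (fun _ => (1 : ℝ)) |
        strictPast θ J (fun ω => ENNReal.ofReal (θ k n ω))]
      =ᵐ[P] fun ω => M.jumpProb k (leftValue (fun s => J k s ω) (θ k n ω)) x
  /-- At the first ruin time, if finite, both environments switch independently. -/
  switch : ∀ y : ∀ k, S k,
    P[Set.indicator {ω | tau1 M (fun k s => J k s ω) < ⊤ ∧
          ∀ k, J k (tau1 M (fun k s => J k s ω)).toReal ω = .inr (y k)} (fun _ => (1 : ℝ)) |
        strictPast θ J (fun ω => tau1 M (fun k s => J k s ω))]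
      =ᵐ[P] Set.indicator {ω | tau1 M (fun k s => J k s ω) < ⊤} (fun ω =>
        ∏ k, M.switchProb k
          (leftValue (fun s => J k s ω) (tau1 M (fun k s => J k s ω)).toReal) (y k))

/-- `θhat 0` and `θhat 1` are the arrival times of Poisson processes of intensity `c`, such that
they and the fluid process `(θ, J)` are mutually independent. -/
structure IsExtraGrid (P : Measure Ω) (θ : Fin 2 → ℕ → Ω → ℝ) (J : ∀ k, ℝ → Ω → E k ⊕ S k)
    (c : ℝ) (θhat : Fin 2 → ℕ → Ω → ℝ) : Prop where
  poisson : ∀ k, IsPoissonArrivals P c (θhat k)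
  indep : IndepFun (fun ω n => θhat 0 n ω) (fun ω n => θhat 1 n ω) P
  indep_fluid : Indep (strictPast θ J (fun _ => ⊤))
    (MeasurableSpace.comap (fun ω k n => θhat k n ω) inferInstance) P

/-- The arrival times of the grids: the superpositions of `θ k` and `θhat k`. -/
def gridOf (θ θhat : Fin 2 → ℕ → Ω → ℝ) (ω : Ω) : Fin 2 → ℕ → ℝ :=
  fun k => superpose (fun n => θ k n ω) (fun n => θhat k n ω)

/-- The event that both ruin times are finite. -/
def ruinEvent (J : ∀ k, ℝ → Ω → E k ⊕ S k) : Set Ω :=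
  {ω | tau1 M (fun k t => J k t ω) < ⊤ ∧ tau2 M (fun k t => J k t ω) < ⊤}

end Model

end RuinFluid

end

/-! The limit statement reduces to a deterministic estimate on a path, an almost sure nondegeneracy
property, and a law of large numbers for the grids.

Grids. The extra points have intensity `γ - γ₀`, and only boundedly many original points fall in a
bounded time with high probability. So Chebyshev's inequality at finitely many indices, with
monotonicity in between, shows that the `n`-th grid point is uniformly close to `n / γ` on bounded
intervals (`tendsto_measure_not_gridClose`).

Nondegeneracy. Let `a` be ruined first and `b` be the other component. Levels are piecewise linear
with nonzero slopes, so ruin times and levels at arrivals are rational expressions in the rates and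
the arrival times. Simultaneous ruin, or a zero of level `b` at one of its arrivals, would put one
gap of `b` into the field generated by the rates, the arrivals of `a` and the other gaps of `b`.
That field is countable and its elements are independent of the gap, whose law is diffuse, so this
has probability zero (`ae_notMem_subfield_closure`, `IsRuinFluid.ae_nondegenerate`). Working with a
field treats all environment sequences at once.

Path estimate. Nondegeneracy forces level `b` to cross zero strictly downwards inside a linear piece
(`RegularPath.exists_crossing`), which leaves a positive margin on both sides. Both components use
the same grid index `ℓ_*`, so closeness of the grids puts both switching times near the first ruin
time, whether or not the pasting is compatible. The pasted level then differs from the true one by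
less than the margin, and its first negative grid point is near the second ruin time
(`RegularPath.edist_approx_le`).

Assembly. The margin is random. It is at least a deterministic one outside an event of small
probability; this margin is fixed first, and `γ` tends to infinity afterwards
(`tendsto_measure_approx_far`). -/

namespace RuinFluid

/-! ### Moments and almost sure growth of Poisson arrival times -/

section Poisson

lemma integrable_pow_expMeasure {c : ℝ} (hc : 0 < c) (n : ℕ) :
    Integrable (fun x => x ^ n) (expMeasure c) ∧
      ∫ x, x ^ n ∂expMeasure c = n.factorial / c ^ n := by
  have hpdf : ∀ x, (exponentialPDF c x).toReal • x ^ n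
      = (Set.Ici (0 : ℝ)).indicator (fun x => c * (x ^ ((n + 1 : ℝ) - 1) * Real.exp (-(c * x)))) x := by
    intro x
    rw [exponentialPDF_eq, ENNReal.toReal_ofReal (by split_ifs <;> positivity), Set.indicator_apply]
    simp only [Set.mem_Ici, add_sub_cancel_right, Real.rpow_natCast, smul_eq_mul]
    split_ifs <;> ring
  have hlt : ∀ᵐ x ∂(volume : Measure ℝ), exponentialPDF c x < ⊤ :=
    ae_of_all _ fun x => ENNReal.ofReal_lt_top
  have hm : Measurable (exponentialPDF c) := (measurable_exponentialPDFReal c).ennreal_ofReal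
  have hexp : expMeasure c = volume.withDensity (exponentialPDF c) := rfl
  have hI := Real.integral_rpow_mul_exp_neg_mul_Ioi (a := n + 1) (by positivity) hc
  rw [hexp]
  constructor
  · rw [integrable_withDensity_iff_integrable_smul' hm hlt]
    simp_rw [hpdf]
    rw [integrable_indicator_iff measurableSet_Ici, integrableOn_Ici_iff_integrableOn_Ioi]
    refine Integrable.const_mul ?_ c
    refine (integrableOn_rpow_mul_exp_neg_mul_rpow (p := 1) (s := n) (b := c)
      (by have : (0:ℝ) ≤ n := n.cast_nonneg
          linarith) one_pos hc).congr_fun (fun x _ => ?_) measurableSet_Ioi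
    simp
  · rw [integral_withDensity_eq_integral_toReal_smul hm hlt]
    simp_rw [hpdf]
    rw [integral_indicator measurableSet_Ici, integral_Ici_eq_integral_Ioi, integral_const_mul, hI,
      Real.Gamma_nat_eq_factorial, show ((n : ℝ) + 1) = ((n + 1 : ℕ) : ℝ) by push_cast; rfl,
      Real.rpow_natCast, one_div, inv_pow, pow_succ]
    field_simp

variable {Ω : Type*} [MeasurableSpace Ω] {P : Measure Ω} {c : ℝ} {θ : ℕ → Ω → ℝ}

lemma memLp_two_of_hasLaw_exp (hc : 0 < c) {X : Ω → ℝ} (h : HasLaw X (expMeasure c) P) :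
    MemLp X 2 P ∧ P[X] = 1 / c ∧ Var[X; P] = 1 / c ^ 2 := by
  have := isProbabilityMeasure_expMeasure hc
  have h1 := integrable_pow_expMeasure hc 1
  have h2 := integrable_pow_expMeasure hc 2
  have hid : MemLp (id : ℝ → ℝ) 2 (expMeasure c) :=
    (memLp_two_iff_integrable_sq aestronglyMeasurable_id).2 h2.1
  have hP : IsProbabilityMeasure P := h.isProbabilityMeasure
  refine ⟨?_, ?_, ?_⟩
  · have := hid
    rw [← h.map_eq] at this
    exact (memLp_map_measure_iff aestronglyMeasurable_id h.aemeasurable).1 this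
  · rw [h.integral_eq]; simpa using h1.2
  · rw [h.variance_eq, variance_eq_sub hid]
    have e1 := h1.2
    have e2 := h2.2
    simp only [pow_one] at e1
    simp only [Pi.pow_apply, id_eq, e1, e2]
    norm_num [Nat.factorial]
    field_simp
    norm_num

lemma IsPoissonArrivals.eq_sum (h : IsPoissonArrivals P c θ) (n : ℕ) :
    θ n = ∑ i ∈ Finset.range n, fun ω => θ (i + 1) ω - θ i ω := by
  funext ω
  rw [Finset.sum_apply, Finset.sum_range_sub (fun i => θ i ω), h.zero, sub_zero]

/-- Chebyshev's inequality for the arrival times of a Poisson process. -/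
lemma IsPoissonArrivals.measure_abs_sub_ge_le [IsProbabilityMeasure P] (hc : 0 < c)
    (h : IsPoissonArrivals P c θ) (n : ℕ) {δ : ℝ} (hδ : 0 < δ) :
    P {ω | δ ≤ |θ n ω - n / c|} ≤ ENNReal.ofReal (n / (c ^ 2 * δ ^ 2)) := by
  have hL : ∀ i, MemLp (fun ω => θ (i + 1) ω - θ i ω) 2 P := fun i =>
    (memLp_two_of_hasLaw_exp hc (h.law i)).1
  have hM : MemLp (θ n) 2 P := by
    rw [h.eq_sum n]; exact memLp_finsetSum' _ fun i _ => hL i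
  have hE : P[θ n] = n / c := by
    rw [h.eq_sum n]
    simp only [Finset.sum_apply]
    rw [integral_finsetSum _ fun i _ => (hL i).integrable (by norm_num)]
    rw [Finset.sum_congr rfl fun i _ => (memLp_two_of_hasLaw_exp hc (h.law i)).2.1]
    simp [div_eq_mul_inv]
  have hV : Var[θ n; P] = n / c ^ 2 := by
    rw [h.eq_sum n, IndepFun.variance_sum (fun i _ => hL i)
      (fun i _ j _ hij => h.indep.indepFun hij),
      Finset.sum_congr rfl fun i _ => (memLp_two_of_hasLaw_exp hc (h.law i)).2.2]
    simp [div_eq_mul_inv]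
  have := meas_ge_le_variance_div_sq hM hδ
  rwa [hE, hV, div_div] at this

lemma expMeasure_singleton (c x : ℝ) : expMeasure c {x} = 0 := by
  have hexp : expMeasure c = volume.withDensity (exponentialPDF c) := rfl
  rw [hexp]
  exact withDensity_absolutelyContinuous _ _ (measure_singleton x)

lemma IsPoissonArrivals.ae_strictMono
    (h : IsPoissonArrivals P c θ) : ∀ᵐ ω ∂P, StrictMono fun n => θ n ω := by
  have : ∀ᵐ x ∂(expMeasure c), 0 < x := by
    have hexp : expMeasure c = volume.withDensity (exponentialPDF c) := rfl
    have hm : Measurable (exponentialPDF c) := (measurable_exponentialPDFReal c).ennreal_ofReal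
    rw [ae_iff, hexp]
    simp only [not_lt]
    change (volume.withDensity (exponentialPDF c)) (Set.Iic 0) = 0
    rw [withDensity_apply _ measurableSet_Iic, ← setLIntegral_congr Iio_ae_eq_Iic,
      lintegral_exponentialPDF_of_nonpos le_rfl]
  have h2 : ∀ n, ∀ᵐ ω ∂P, 0 < θ (n + 1) ω - θ n ω := fun n =>
    ((h.law n).ae_iff (p := fun x => 0 < x) (measurableSet_setOfPred.1 measurableSet_Ioi)).2 this
  filter_upwards [ae_all_iff.2 h2] with ω hω
  exact strictMono_nat_of_lt_succ fun n => by linarith [hω n]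

lemma IsPoissonArrivals.tendsto_measure_le [IsProbabilityMeasure P] (hc : 0 < c)
    (h : IsPoissonArrivals P c θ) (t : ℝ) :
    Tendsto (fun n => P {ω | θ n ω ≤ t}) atTop (𝓝 0) := by
  have hlim : Tendsto (fun n : ℕ => ENNReal.ofReal (4 / n)) atTop (𝓝 0) := by
    rw [← ENNReal.ofReal_zero]
    exact ENNReal.tendsto_ofReal (tendsto_const_div_atTop_nhds_zero_nat 4)
  refine tendsto_of_tendsto_of_tendsto_of_le_of_le' tendsto_const_nhds hlim
    (Eventually.of_forall fun _ => zero_le) ?_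
  filter_upwards [eventually_gt_atTop 0, eventually_ge_atTop ⌈2 * c * t⌉₊] with n hn hn2
  have hn' : (0 : ℝ) < n := by exact_mod_cast hn
  have h1 : 2 * c * t ≤ n := Nat.ceil_le.1 hn2
  have h2 : t ≤ n / (2 * c) := by rw [le_div_iff₀ (by positivity)]; linarith
  have h3 : (n : ℝ) / c = n / (2 * c) + n / (2 * c) := by field_simp; ring
  -- Once `t` is at most half the mean `n / c`, the event is a deviation by half the mean, and
  -- Chebyshev gives `4 / n`.
  calc P {ω | θ n ω ≤ t} ≤ P {ω | n / (2 * c) ≤ |θ n ω - n / c|} := by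
        refine measure_mono fun ω (hω : θ n ω ≤ t) => ?_
        rw [Set.mem_ofPred_eq, abs_sub_comm]
        exact le_trans (by linarith) (le_abs_self _)
    _ ≤ _ := h.measure_abs_sub_ge_le hc n (by positivity)
    _ = _ := by congr 1; field_simp; norm_num

lemma IsPoissonArrivals.ae_tendsto [IsProbabilityMeasure P] (hc : 0 < c)
    (h : IsPoissonArrivals P c θ) : ∀ᵐ ω ∂P, Tendsto (fun n => θ n ω) atTop atTop := by
  have h0 : ∀ m : ℕ, ∀ᵐ ω ∂P, ∃ n, (m : ℝ) < θ n ω := by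
    intro m
    rw [ae_iff]
    push Not
    refine le_antisymm (ge_of_tendsto (h.tendsto_measure_le hc m) (Eventually.of_forall fun n =>
      measure_mono fun ω hω => hω n)) zero_le
  filter_upwards [ae_all_iff.2 h0, h.ae_strictMono] with ω h1 h2
  refine tendsto_atTop_atTop_of_monotone h2.monotone fun b => ?_
  obtain ⟨n, hn⟩ := h1 ⌈b⌉₊
  exact ⟨n, (Nat.le_ceil b).trans hn.le⟩

end Poisson

section Grid

/-! ### Grids -/

lemma le_countArrivals {b : ℕ → ℝ} (hb : StrictMono b) {n : ℕ} {t : ℝ} (h : b n ≤ t) :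
    (n : ℕ∞) ≤ countArrivals b t := by
  have hsub : ((Finset.Icc 1 n : Finset ℕ) : Set ℕ) ⊆ {m : ℕ | 1 ≤ m ∧ b m ≤ t} := fun m hm => by
    rw [Finset.mem_coe, Finset.mem_Icc] at hm
    exact ⟨hm.1, (hb.monotone hm.2).trans h⟩
  have := Set.encard_le_encard hsub
  rwa [Set.encard_coe_eq_coe_finsetCard, Nat.card_Icc, Nat.add_sub_cancel] at this

lemma countArrivals_le {b : ℕ → ℝ} (hb : StrictMono b) {n : ℕ} {t : ℝ} (h : t < b (n + 1)) :
    countArrivals b t ≤ n := by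
  have hsub : {m : ℕ | 1 ≤ m ∧ b m ≤ t} ⊆ ((Finset.Icc 1 n : Finset ℕ) : Set ℕ) := fun m hm => by
    rw [Finset.mem_coe, Finset.mem_Icc]
    exact ⟨hm.1, Nat.lt_succ_iff.1 (hb.lt_iff_lt.1 (hm.2.trans_lt h))⟩
  have := Set.encard_le_encard hsub
  rwa [Set.encard_coe_eq_coe_finsetCard, Nat.card_Icc, Nat.add_sub_cancel] at this

lemma superpose_nonneg (a b : ℕ → ℝ) (n : ℕ) : 0 ≤ superpose a b n :=
  Real.sInf_nonneg fun _ h => h.1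

lemma mem_superpose_set (a : ℕ → ℝ) {b : ℕ → ℝ} (hb : StrictMono b) (hb0 : b 0 = 0) (n : ℕ) :
    b n ∈ {t : ℝ | 0 ≤ t ∧ (n : ℕ∞) ≤ countArrivals a t + countArrivals b t} :=
  ⟨hb0 ▸ hb.monotone n.zero_le, (le_countArrivals hb le_rfl).trans le_add_self⟩

lemma superpose_le (a : ℕ → ℝ) {b : ℕ → ℝ} (hb : StrictMono b) (hb0 : b 0 = 0) (n : ℕ) :
    superpose a b n ≤ b n :=
  csInf_le ⟨0, fun _ h => h.1⟩ (mem_superpose_set a hb hb0 n)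

/-- Before `x` there are at most `k` arrivals of `a` and `l` of `b`, too few for the point of index
`k + l + 1`. -/
lemma le_superpose {a b : ℕ → ℝ} (ha : StrictMono a) (hb : StrictMono b) (hb0 : b 0 = 0)
    (k l : ℕ) {x : ℝ} (hxa : x ≤ a (k + 1)) (hxb : x ≤ b (l + 1)) :
    x ≤ superpose a b (k + l + 1) := by
  refine le_csInf ⟨_, mem_superpose_set a hb hb0 _⟩ fun t ht => ?_
  by_contra! hlt
  have h1 := countArrivals_le ha (hlt.trans_le hxa)
  have h2 := countArrivals_le hb (hlt.trans_le hxb)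
  have h3 := ht.2.trans (add_le_add h1 h2)
  norm_cast at h3
  omega

/-- Up to time `T`, the `n`-th point of `g` is close to `n / γ`. -/
def GridClose (γ T δ : ℝ) (g : ℕ → ℝ) : Prop :=
  ∀ n : ℕ, (n : ℝ) ≤ γ * T → |g n - n / γ| ≤ δ

/-- Monotonicity traps `h n` between its values at two neighbouring mesh indices, so uniform
closeness costs only finitely many conditions and one more `δ`. -/
lemma gridClose_of_mesh {γ T δ : ℝ} (hγ : 0 < γ) (hδ : 0 < δ) {h : ℕ → ℝ} (hh : Monotone h)
    (hmesh : ∀ j : ℕ, j ≤ ⌊T / δ⌋₊ + 1 → |h ⌈j * δ * γ⌉₊ - j * δ| ≤ δ) :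
    GridClose γ T (2 * δ) h := by
  intro n hn
  have hγδ : 0 < γ * δ := mul_pos hγ hδ
  set j := ⌊n / (γ * δ)⌋₊ with hj
  have hj1 : (j : ℝ) ≤ n / (γ * δ) := Nat.floor_le (by positivity)
  have hj2 : n / (γ * δ) < j + 1 := Nat.lt_floor_add_one _
  rw [le_div_iff₀ hγδ] at hj1
  rw [div_lt_iff₀ hγδ] at hj2
  have hjT : j ≤ ⌊T / δ⌋₊ := Nat.floor_mono (by
    rw [div_le_div_iff₀ hγδ hδ]; nlinarith)
  have hlo : h ⌈j * δ * γ⌉₊ ≤ h n := hh (Nat.ceil_le.2 (by linarith))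
  have hup : h n ≤ h ⌈(j + 1 : ℕ) * δ * γ⌉₊ := hh (by
    have : (n : ℝ) ≤ ⌈(j + 1 : ℕ) * δ * γ⌉₊ := le_trans (by push_cast; linarith) (Nat.le_ceil _)
    exact_mod_cast this)
  have h1 := abs_le.1 (hmesh j (by omega))
  have h2 := abs_le.1 (hmesh (j + 1) (by omega))
  have h3 : j * δ ≤ n / γ := by rw [le_div_iff₀ hγ]; linarith
  have h4 : n / γ ≤ (j + 1) * δ := by rw [div_le_iff₀ hγ]; linarith
  push_cast at h2 hup
  rw [abs_le]
  constructor <;> linarith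

/-- Adding `a` can only move the `n`-th point to the left. Before `T` it shifts the index by at most
`⌊δ * γ⌋₊`, hence the time scale `n / γ` by at most `δ`. -/
lemma gridClose_superpose {γ T δ : ℝ} (hγ : 0 < γ) (hδ : 0 < δ) {a b : ℕ → ℝ}
    (ha : StrictMono a) (hb : StrictMono b) (hb0 : b 0 = 0) (haT : T ≤ a (⌊δ * γ⌋₊ + 1))
    (hclose : GridClose γ T (2 * δ) b) : GridClose γ T (3 * δ) (superpose a b) := by
  intro n hn
  have hup := superpose_le a hb hb0 n
  have h1 := abs_le.1 (hclose n hn)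
  set k := ⌊δ * γ⌋₊ with hk
  have hk1 : (k : ℝ) ≤ δ * γ := Nat.floor_le (by positivity)
  rw [abs_le]
  refine ⟨?_, by linarith⟩
  rcases le_or_gt n k with hnk | hnk
  · have : (n : ℝ) / γ ≤ δ := by
      rw [div_le_iff₀ hγ]; exact le_trans (by exact_mod_cast hnk) hk1
    have := superpose_nonneg a b n
    linarith
  · obtain ⟨l, rfl⟩ : ∃ l, n = k + l + 1 := ⟨n - k - 1, by omega⟩
    have hn' : ((l + 1 : ℕ) : ℝ) ≤ γ * T := le_trans (by push_cast; linarith) hn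
    have h2 := abs_le.1 (hclose (l + 1) hn')
    have h3 : ((k + l + 1 : ℕ) : ℝ) / γ - δ ≤ ((l + 1 : ℕ) : ℝ) / γ := by
      rw [sub_le_iff_le_add, div_le_iff₀ hγ, add_mul, div_mul_cancel₀ _ hγ.ne']
      push_cast; linarith
    have h4 : ((k + l + 1 : ℕ) : ℝ) / γ ≤ T := by rw [div_le_iff₀ hγ]; linarith
    -- The bound on the number of points of `a` is available only up to `T`, hence the minimum.
    have := le_superpose ha hb hb0 k l (x := min T (((l + 1 : ℕ) : ℝ) / γ - 2 * δ))
      ((min_le_left _ _).trans haT) ((min_le_right _ _).trans (by linarith))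
    rcases min_le_iff.1 this with h | h <;> linarith

variable {Ω : Type*} [MeasurableSpace Ω] {P : Measure Ω}

lemma tendsto_ceil_div_sub (x c₀ : ℝ) (hx : 0 ≤ x) :
    Tendsto (fun γ : ℝ => (⌈x * γ⌉₊ : ℝ) / (γ - c₀)) atTop (𝓝 x) := by
  have h1 : Tendsto (fun γ : ℝ => (⌈x * γ⌉₊ : ℝ) / γ) atTop (𝓝 x) :=
    tendsto_nat_ceil_mul_div_atTop hx
  have h2 : Tendsto (fun γ : ℝ => 1 - c₀ / γ) atTop (𝓝 1) := by
    simpa using (tendsto_const_nhds (x := (1 : ℝ))).sub (tendsto_const_nhds.div_atTop tendsto_id)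
  have h3 := h1.div h2 one_ne_zero
  rw [div_one] at h3
  refine h3.congr' ?_
  filter_upwards [eventually_gt_atTop 0, eventually_gt_atTop c₀] with γ h0 hc
  have : γ - c₀ ≠ 0 := by linarith
  simp only [Pi.div_apply]
  field_simp

/-- The superposition of a fixed Poisson process and one of intensity
`γ - c₀` is uniformly close on bounded time intervals to the regular grid of mesh `1 / γ`. -/
lemma tendsto_measure_not_gridClose [IsProbabilityMeasure P] {c₀ : ℝ} (hc : 0 < c₀)
    {θ : ℕ → Ω → ℝ} (hθ : IsPoissonArrivals P c₀ θ) {θh : ℝ → ℕ → Ω → ℝ}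
    (hh : ∀ γ, c₀ < γ → IsPoissonArrivals P (γ - c₀) (θh γ)) (T : ℝ) {δ : ℝ} (hδ : 0 < δ) :
    Tendsto (fun γ : ℝ =>
      P {ω | ¬ GridClose γ T δ (superpose (fun n => θ n ω) (fun n => θh γ n ω))}) atTop (𝓝 0) := by
  obtain ⟨δ, rfl⟩ : ∃ d, δ = 3 * d := ⟨δ / 3, by ring⟩
  replace hδ : 0 < δ := by linarith
  set m := ⌊T / δ⌋₊ + 1 with hm
  have hA : Tendsto (fun γ : ℝ => P {ω | θ (⌊δ * γ⌋₊ + 1) ω ≤ T}) atTop (𝓝 0) :=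
    (hθ.tendsto_measure_le hc T).comp ((tendsto_add_atTop_nat 1).comp
      (tendsto_nat_floor_atTop.comp (tendsto_id.const_mul_atTop hδ)))
  -- The Chebyshev bound has an index of order `γ` over a squared intensity of order `γ ^ 2`. The
  -- other `δ / 2` of the mesh error pays for replacing the mean by `j * δ`.
  have hB : ∀ j : ℕ, Tendsto (fun γ : ℝ =>
      P {ω | δ / 2 ≤ |θh γ ⌈j * δ * γ⌉₊ ω - ⌈j * δ * γ⌉₊ / (γ - c₀)|}) atTop (𝓝 0) := by
    intro j
    have h1 := tendsto_ceil_div_sub (j * δ) c₀ (by positivity)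
    have h2 : Tendsto (fun γ : ℝ => 1 / ((γ - c₀) * (δ / 2) ^ 2)) atTop (𝓝 0) :=
      tendsto_const_nhds.div_atTop
        ((tendsto_atTop_add_const_right _ _ tendsto_id).atTop_mul_const (by positivity))
    have h3 : Tendsto (fun γ : ℝ => ENNReal.ofReal
        ((⌈j * δ * γ⌉₊ : ℝ) / ((γ - c₀) ^ 2 * (δ / 2) ^ 2))) atTop (𝓝 0) := by
      rw [← ENNReal.ofReal_zero]
      refine ENNReal.tendsto_ofReal ?_
      have := h1.mul h2
      rw [mul_zero] at this
      refine this.congr fun γ => ?_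
      rw [div_mul_div_comm, mul_one]; ring_nf
    refine tendsto_of_tendsto_of_tendsto_of_le_of_le' tendsto_const_nhds h3
      (Eventually.of_forall fun _ => zero_le) ?_
    filter_upwards [eventually_gt_atTop c₀] with γ hγ
    exact (hh γ hγ).measure_abs_sub_ge_le (by linarith) _ (by positivity)
  have hsum := hA.add (tendsto_finsetSum (Finset.range (m + 1)) fun j _ => hB j)
  simp only [Finset.sum_const_zero, add_zero] at hsum
  have hclose : ∀ᶠ γ : ℝ in atTop, ∀ j ∈ Finset.range (m + 1),
      |(⌈j * δ * γ⌉₊ : ℝ) / (γ - c₀) - j * δ| < δ / 2 := by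
    rw [Finset.eventually_all]
    intro j _
    have := (tendsto_ceil_div_sub (j * δ) c₀ (by positivity)).eventually
      (Metric.ball_mem_nhds _ (half_pos hδ))
    filter_upwards [this] with γ hγ using hγ
  refine tendsto_of_tendsto_of_tendsto_of_le_of_le' tendsto_const_nhds hsum
    (Eventually.of_forall fun _ => zero_le) ?_
  filter_upwards [hclose, eventually_gt_atTop c₀] with γ h1 hγ
  have hγ0 : 0 < γ := hc.trans hγ
  refine (measure_mono_ae (t := {ω | θ (⌊δ * γ⌋₊ + 1) ω ≤ T} ∪ ⋃ j ∈ Finset.range (m + 1),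
      {ω | δ / 2 ≤ |θh γ ⌈j * δ * γ⌉₊ ω - ⌈j * δ * γ⌉₊ / (γ - c₀)|}) ?_).trans
    ((measure_union_le _ _).trans (by gcongr; exact measure_biUnion_finset_le _ _))
  filter_upwards [hθ.ae_strictMono, (hh γ hγ).ae_strictMono] with ω ha hb hω
  change ω ∈ (_ ∪ _ : Set Ω)
  by_contra hnot
  simp only [Set.mem_union, Set.mem_iUnion, not_or, not_exists] at hnot
  refine hω (gridClose_superpose hγ0 hδ ha hb ((hh γ hγ).zero ω) (not_le.1 hnot.1).le
    (gridClose_of_mesh hγ0 hδ hb.monotone fun j hj => ?_))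
  have hj' : j ∈ Finset.range (m + 1) := Finset.mem_range.2 (by omega)
  have h2 := abs_lt.1 (h1 j hj')
  have h3 : |θh γ ⌈j * δ * γ⌉₊ ω - ⌈j * δ * γ⌉₊ / (γ - c₀)| < δ / 2 :=
    lt_of_not_ge fun h => hnot.2 j hj' h
  replace h3 := abs_lt.1 h3
  rw [abs_le]
  constructor <;> linarith

end Grid

/-! ### Measurability of right-locally-constant processes -/

/-- Sampling at the next multiple of `1 / (m + 1)` strictly to the right uses countably many times,
so it is jointly measurable. Local constancy to the right makes these samples eventually equal to
the value itself. -/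
lemma measurable_uncurry_of_right_locally_const {Ω : Type*} [MeasurableSpace Ω] (f : ℝ → Ω → ℝ)
    (hm : ∀ t, 0 ≤ t → Measurable (f t))
    (hr : ∀ ω t, 0 ≤ t → ∃ u > t, ∀ s ∈ Set.Ico t u, f s ω = f t ω) :
    Measurable fun p : ℝ × Ω => if 0 ≤ p.1 then f p.1 p.2 else 0 := by
  have happ : ∀ m : ℕ, Measurable fun p : ℝ × Ω =>
      if 0 ≤ p.1 then f (((⌊p.1 * (m + 1)⌋₊ : ℝ) + 1) / (m + 1)) p.2 else 0 := by
    intro m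
    refine Measurable.ite (measurableSet_le measurable_const measurable_fst) ?_ measurable_const
    have h1 : Measurable fun q : ℕ × Ω => f (((q.1 : ℝ) + 1) / (m + 1)) q.2 :=
      measurable_from_prod_countable_right fun n =>
        hm (((n : ℝ) + 1) / (m + 1)) (by positivity)
    exact h1.comp ((Nat.measurable_floor.comp (measurable_fst.mul_const _)).prodMk measurable_snd)
  refine measurable_of_tendsto_metrizable happ (tendsto_pi_nhds.2 fun p => ?_)
  by_cases hp : 0 ≤ p.1
  · simp only [hp, if_true]
    obtain ⟨u, hu, hc⟩ := hr p.2 p.1 hp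
    have h0 : Tendsto (fun m : ℕ => (1 : ℝ) / (m + 1)) atTop (𝓝 0) :=
      tendsto_one_div_add_atTop_nhds_zero_nat
    refine tendsto_const_nhds.congr' ?_
    filter_upwards [h0.eventually (gt_mem_nhds (sub_pos.2 hu))] with m hm'
    have hm0 : (0 : ℝ) < m + 1 := by positivity
    refine (hc _ ⟨?_, ?_⟩).symm
    · rw [le_div_iff₀ hm0]; exact (Nat.lt_floor_add_one _).le
    · have h2 : (⌊p.1 * (m + 1)⌋₊ : ℝ) ≤ p.1 * (m + 1) := Nat.floor_le (by positivity)
      rw [add_div]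
      have : (⌊p.1 * (m + 1)⌋₊ : ℝ) / (m + 1) ≤ p.1 := by rwa [div_le_iff₀ hm0]
      linarith
  · simp [hp]

lemma infTime_le {A : Set ℝ} {s : ℝ} (hs : s ∈ A) : infTime A ≤ ENNReal.ofReal s :=
  iInf₂_le s hs

lemma exists_mem_of_infTime_lt {A : Set ℝ} {b : ℝ≥0∞} (h : infTime A < b) :
    ∃ s ∈ A, ENNReal.ofReal s < b := by
  obtain ⟨s, hs⟩ := iInf_lt_iff.1 h
  obtain ⟨hsA, hs⟩ := iInf_lt_iff.1 hs
  exact ⟨s, hsA, hs⟩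

/-! ### Deterministic paths: piecewise linear levels, ruin times and the crossing of zero -/

section Path

variable {E S : Fin 2 → Type*} [∀ k, Fintype (E k)] [∀ k, Fintype (S k)]
  {M : Params E S} {J : ∀ k, ℝ → E k ⊕ S k} {θ : Fin 2 → ℕ → ℝ}

lemma Params.exists_rate_bound (M : Params E S) : ∃ C : ℝ, 0 < C ∧ ∀ k x, |M.rate k x| ≤ C := by
  refine ⟨∑ k, ∑ x, |M.rate k x| + 1, by positivity, fun k x => ?_⟩
  have h1 : |M.rate k x| ≤ ∑ x, |M.rate k x| :=
    Finset.single_le_sum (f := fun x => |M.rate k x|) (fun _ _ => abs_nonneg _) (Finset.mem_univ x)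
  have h2 : ∑ x, |M.rate k x| ≤ ∑ k, ∑ x, |M.rate k x| :=
    Finset.single_le_sum (f := fun k => ∑ x, |M.rate k x|)
      (fun _ _ => Finset.sum_nonneg fun _ _ => abs_nonneg _) (Finset.mem_univ k)
  linarith

lemma Params.rate_ne_zero (M : Params E S) (k : Fin 2) (x : E k ⊕ S k) : M.rate k x ≠ 0 := by
  cases x with
  | inl i => exact M.r_ne k i
  | inr i => exact M.ρ_ne k i

variable (M J θ) in
/-- A pair of environment paths with the almost sure properties of the fluid process. -/
structure RegularPath : Prop where
  zero : ∀ k, θ k 0 = 0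
  strictMono : ∀ k, StrictMono (θ k)
  tendsto : ∀ k, Tendsto (θ k) atTop atTop
  init : ∀ k, J k 0 = .inl (M.init k)
  before : ∀ k t, 0 ≤ t → ((J k t).isLeft ↔ ENNReal.ofReal t < tau1 M J)
  const : ∀ k s t, 0 ≤ s → s ≤ t → (∀ n, θ k n ∉ Set.Ioc s t) →
    ¬ (ENNReal.ofReal s < tau1 M J ∧ tau1 M J ≤ ENNReal.ofReal t) → J k s = J k t

namespace RegularPath

variable (h : RegularPath M J θ)
include h

lemma exists_mem_Ico (k : Fin 2) {t : ℝ} (ht : 0 ≤ t) : ∃ n, θ k n ≤ t ∧ t < θ k (n + 1) := by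
  classical
  have hex : ∃ n, t < θ k n := ((h.tendsto k).eventually_gt_atTop t).exists
  obtain ⟨n, hn⟩ : ∃ n, Nat.find hex = n + 1 := Nat.exists_eq_succ_of_ne_zero fun h0 => by
    have := Nat.find_spec hex
    rw [h0, h.zero] at this
    linarith
  exact ⟨n, not_lt.1 (Nat.find_min hex (by omega)), hn ▸ Nat.find_spec hex⟩

lemma exists_mem_Ioc (k : Fin 2) {t : ℝ} (ht : 0 < t) : ∃ n, θ k n < t ∧ t ≤ θ k (n + 1) := by
  obtain ⟨n, h1, h2⟩ := h.exists_mem_Ico k ht.le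
  rcases h1.lt_or_eq with h1 | h1
  · exact ⟨n, h1, h2.le⟩
  · obtain ⟨m, rfl⟩ : ∃ m, n = m + 1 := Nat.exists_eq_succ_of_ne_zero fun h0 => by
      rw [h0, h.zero] at h1; linarith
    exact ⟨m, h1 ▸ h.strictMono k m.lt_succ_self, h1.ge⟩

lemma arrival_nonneg (k : Fin 2) (n : ℕ) : 0 ≤ θ k n :=
  h.zero k ▸ (h.strictMono k).monotone n.zero_le

lemma arrival_pos (k : Fin 2) (n : ℕ) : 0 < θ k (n + 1) :=
  h.zero k ▸ (h.strictMono k) n.succ_pos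

lemma notMem_Ioo (k : Fin 2) {n : ℕ} {s t : ℝ} (hs : θ k n ≤ s) (ht : t ≤ θ k (n + 1)) (m : ℕ) :
    θ k m ∉ Set.Ioo s t := fun hm => by
  have h1 := (h.strictMono k).lt_iff_lt.1 (hs.trans_lt hm.1)
  have h2 := (h.strictMono k).lt_iff_lt.1 (hm.2.trans_le ht)
  omega

lemma tau1_pos : 0 < tau1 M J := by
  have := (h.before 0 0 le_rfl).1 (by rw [h.init]; rfl)
  simpa using this

lemma eq_of_mem_Ico (k : Fin 2) {s t u : ℝ} (hs : 0 ≤ s) (hu : u ∈ Set.Ico s t)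
    (hθ : ∀ n, θ k n ∉ Set.Ioo s t)
    (hτ : ¬ (ENNReal.ofReal s < tau1 M J ∧ tau1 M J < ENNReal.ofReal t)) : J k u = J k s :=
  (h.const k s u hs hu.1 (fun n hn => hθ n ⟨hn.1, hn.2.trans_lt hu.2⟩) fun hh => hτ ⟨hh.1,
    hh.2.trans_lt ((ENNReal.ofReal_lt_ofReal_iff (by linarith [hu.1, hu.2])).2 hu.2)⟩).symm

lemma right_locally_const (k : Fin 2) {t : ℝ} (ht : 0 ≤ t) :
    ∃ u > t, ∀ s ∈ Set.Ico t u, J k s = J k t := by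
  obtain ⟨n, h1, h2⟩ := h.exists_mem_Ico k ht
  rcases lt_or_ge (ENNReal.ofReal t) (tau1 M J) with hτ | hτ
  · obtain ⟨v, hv, hv1, hv2⟩ := ENNReal.lt_iff_exists_real_btwn.1 hτ
    have htv : t < v := (ENNReal.ofReal_lt_ofReal_iff_of_nonneg ht).1 hv1
    refine ⟨min v (θ k (n + 1)), lt_min htv h2, fun s hs => h.eq_of_mem_Ico k ht hs
      (h.notMem_Ioo k h1 (min_le_right _ _)) fun hh => ?_⟩
    exact absurd (hh.2.trans_le (ENNReal.ofReal_le_ofReal (min_le_left _ _))) hv2.not_gt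
  · exact ⟨θ k (n + 1), h2, fun s hs => h.eq_of_mem_Ico k ht hs
      (h.notMem_Ioo k h1 le_rfl) fun hh => hτ.not_gt hh.1⟩

lemma exists_measurable_rate (k : Fin 2) :
    ∃ g : ℝ → ℝ, Measurable g ∧ ∀ t, 0 ≤ t → g t = M.rate k (J k t) := by
  have := measurable_uncurry_of_right_locally_const (Ω := Unit) (fun t _ => M.rate k (J k t))
    (fun _ _ => measurable_const) fun _ t ht => by
      obtain ⟨u, hu, hc⟩ := h.right_locally_const k ht
      exact ⟨u, hu, fun s hs => by rw [hc s hs]⟩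
  exact ⟨fun t => if 0 ≤ t then M.rate k (J k t) else 0,
    this.comp (measurable_id.prodMk (measurable_const (a := ()))), fun t ht => if_pos ht⟩

lemma intervalIntegrable (k : Fin 2) {s t : ℝ} (hs : 0 ≤ s) (ht : 0 ≤ t) :
    IntervalIntegrable (fun x => M.rate k (J k x)) volume s t := by
  obtain ⟨g, hg, hgJ⟩ := h.exists_measurable_rate k
  obtain ⟨C, -, hC⟩ := M.exists_rate_bound
  have hpos : ∀ x ∈ Set.uIoc s t, 0 ≤ x := fun x hx => (le_min hs ht).trans hx.1.le
  have : IntervalIntegrable (fun _ : ℝ => C) volume s t := intervalIntegrable_const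
  refine this.mono_fun (hg.aestronglyMeasurable.congr ?_) ?_
  · filter_upwards [ae_restrict_mem measurableSet_uIoc] with x hx using hgJ x (hpos x hx)
  · exact ae_of_all _ fun x => (hC k _).trans (le_abs_self C)

omit h in
lemma level_zero (k : Fin 2) : level M J k 0 = 0 := by simp [level]

lemma level_sub (k : Fin 2) {s t : ℝ} (hs : 0 ≤ s) (ht : 0 ≤ t) :
    level M J k t - level M J k s = ∫ x in s..t, M.rate k (J k x) :=
  intervalIntegral.integral_interval_sub_left (h.intervalIntegrable k le_rfl ht)
    (h.intervalIntegrable k le_rfl hs)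

lemma abs_level_sub_le {C : ℝ} (hC : ∀ k x, |M.rate k x| ≤ C) (k : Fin 2) {s t : ℝ} (hs : 0 ≤ s)
    (ht : 0 ≤ t) : |level M J k t - level M J k s| ≤ C * |t - s| := by
  rw [h.level_sub k hs ht]
  exact intervalIntegral.norm_integral_le_of_norm_le_const
    (f := fun x => M.rate k (J k x)) fun x _ => hC k (J k x)

lemma continuousOn_level (k : Fin 2) : ContinuousOn (level M J k) (Set.Ici 0) := by
  obtain ⟨C, hC0, hC⟩ := M.exists_rate_bound
  refine LipschitzOnWith.continuousOn (K := C.toNNReal) (LipschitzOnWith.of_dist_le_mul ?_)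
  intro x hx y hy
  rw [Real.dist_eq, Real.dist_eq, Real.coe_toNNReal _ hC0.le]
  exact h.abs_level_sub_le hC k hy hx

lemma level_eq_add (k : Fin 2) {s t : ℝ} (hs : 0 ≤ s) (hst : s ≤ t)
    (hθ : ∀ n, θ k n ∉ Set.Ioo s t)
    (hτ : ¬ (ENNReal.ofReal s < tau1 M J ∧ tau1 M J < ENNReal.ofReal t)) :
    level M J k t = level M J k s + M.rate k (J k s) * (t - s) := by
  have h1 := h.level_sub k hs (hs.trans hst)
  have h2 : ∫ x in s..t, M.rate k (J k x) = ∫ x in s..t, M.rate k (J k s) := by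
    -- The environment is constant on `[s, t)` but may jump at `t`, so the integrals are moved to
    -- the half-open interval that omits `t`.
    rw [intervalIntegral.integral_of_le hst, intervalIntegral.integral_of_le hst,
      ← integral_Ico_eq_integral_Ioc, ← integral_Ico_eq_integral_Ioc]
    exact setIntegral_congr_fun measurableSet_Ico fun x hx => by
      simp only [h.eq_of_mem_Ico k hs hx hθ hτ]
  rw [h2, intervalIntegral.integral_const, smul_eq_mul] at h1
  linarith

lemma level_eq_init (k : Fin 2) {t : ℝ} (ht : 0 ≤ t) (hτ : ENNReal.ofReal t ≤ tau1 M J)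
    (hθ : t ≤ θ k 1) : level M J k t = M.r k (M.init k) * t := by
  have := h.level_eq_add k le_rfl ht (h.notMem_Ioo k (n := 0) (h.zero k).le hθ)
    fun hh => hh.2.not_ge hτ
  rw [this, level_zero, h.init]
  simp [Params.rate]

/-- The initial slope is positive, so the level is positive just after time `0`; the intermediate
value theorem then gives a zero other than the one at the origin. -/
lemma exists_zero_of_neg (k : Fin 2) {t : ℝ} (ht : 0 < t) (hneg : level M J k t < 0) :
    ∃ s ∈ Set.Ioo 0 t, level M J k s = 0 := by
  obtain ⟨v, hv, hv1, hv2⟩ := ENNReal.lt_iff_exists_real_btwn.1 h.tau1_pos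
  have hv0 : 0 < v := ENNReal.ofReal_pos.1 hv1
  set s := min (min v (θ k 1)) t with hs
  have hs0 : 0 < s := lt_min (lt_min hv0 (h.arrival_pos k 0)) ht
  have hsF : 0 < level M J k s := by
    rw [h.level_eq_init k hs0.le ((ENNReal.ofReal_le_ofReal
      ((min_le_left _ _).trans (min_le_left _ _))).trans hv2.le)
      ((min_le_left _ _).trans (min_le_right _ _))]
    exact mul_pos (M.init_pos k) hs0
  have hst : s ≤ t := min_le_right _ _
  obtain ⟨z, hz, hz0⟩ := intermediate_value_Icc' hst
    ((h.continuousOn_level k).mono fun x hx => hs0.le.trans hx.1) ⟨hneg.le, hsF.le⟩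
  refine ⟨z, ⟨hs0.trans_le hz.1, hz.2.lt_of_ne ?_⟩, hz0⟩
  rintro rfl
  linarith

lemma level_pos_of_forall_ne (k : Fin 2) {t : ℝ} (ht : 0 < t)
    (hne : ∀ s ∈ Set.Ioc 0 t, level M J k s ≠ 0) : 0 < level M J k t := by
  by_contra! hle
  obtain ⟨s, hs, hs0⟩ := h.exists_zero_of_neg k ht (hle.lt_of_ne (hne t ⟨ht, le_rfl⟩))
  exact hne s ⟨hs.1, hs.2.le⟩ hs0

omit h in
lemma level_ne_zero_of_lt (k : Fin 2) {t : ℝ} (ht : 0 < t) (hτ : ENNReal.ofReal t < tau1 M J) :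
    level M J k t ≠ 0 := fun h0 => by
  refine hτ.not_ge (infTime_le ⟨ht, ?_⟩)
  fin_cases k
  · exact Or.inl h0
  · exact Or.inr h0

lemma level_pos_of_lt (k : Fin 2) {t : ℝ} (ht : 0 < t) (hτ : ENNReal.ofReal t < tau1 M J) :
    0 < level M J k t :=
  h.level_pos_of_forall_ne k ht fun _ hs => level_ne_zero_of_lt k hs.1
    ((ENNReal.ofReal_le_ofReal hs.2).trans_lt hτ)

omit h in
lemma ofReal_tau1 (hτ : tau1 M J < ⊤) : ENNReal.ofReal (tau1 M J).toReal = tau1 M J :=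
  ENNReal.ofReal_toReal hτ.ne

lemma toReal_tau1_pos (hτ : tau1 M J < ⊤) : 0 < (tau1 M J).toReal :=
  ENNReal.toReal_pos h.tau1_pos.ne' hτ.ne

/-- The infimum is attained: if the continuous product of the levels were nonzero there, no zero
could follow shortly after. -/
lemma level_tau1_eq_zero (hτ : tau1 M J < ⊤) :
    level M J 0 (tau1 M J).toReal = 0 ∨ level M J 1 (tau1 M J).toReal = 0 := by
  set T := (tau1 M J).toReal with hT
  have hT0 : 0 < T := h.toReal_tau1_pos hτ
  by_contra hne
  have hprod : level M J 0 T * level M J 1 T ≠ 0 := mul_ne_zero (fun h => hne (Or.inl h))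
    fun h => hne (Or.inr h)
  have hcont : ContinuousAt (fun t => level M J 0 t * level M J 1 t) T :=
    (((h.continuousOn_level 0).mul (h.continuousOn_level 1)).continuousAt (Ici_mem_nhds hT0))
  obtain ⟨δ, hδ, hball⟩ := Metric.eventually_nhds_iff.1 (hcont.eventually_ne hprod)
  have hlt : infTime {s | 0 < s ∧ (level M J 0 s = 0 ∨ level M J 1 s = 0)}
      < ENNReal.ofReal (T + δ) := by
    change tau1 M J < _
    rw [← ofReal_tau1 hτ]
    exact (ENNReal.ofReal_lt_ofReal_iff (by linarith)).2 (by linarith)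
  obtain ⟨s, ⟨hs0, hs⟩, hslt⟩ := exists_mem_of_infTime_lt hlt
  have h1 : T ≤ s := by
    have : tau1 M J ≤ ENNReal.ofReal s := infTime_le ⟨hs0, hs⟩
    rw [← ofReal_tau1 hτ] at this
    exact (ENNReal.ofReal_le_ofReal_iff hs0.le).1 this
  have h2 : s < T + δ := (ENNReal.ofReal_lt_ofReal_iff (by linarith)).1 hslt
  refine hball (y := s) ?_ (mul_eq_zero.2 hs)
  rw [Real.dist_eq, abs_of_nonneg (by linarith)]
  linarith

lemma level_first_tau1 (hτ : tau1 M J < ⊤) : level M J (first M J) (tau1 M J).toReal = 0 := by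
  have := h.level_tau1_eq_zero hτ
  unfold first
  split_ifs with h0
  · exact h0
  · exact this.resolve_left h0

omit h in
lemma second_ne_first : second M J ≠ first M J := by
  unfold second
  split_ifs with h0
  · rw [h0]; exact one_ne_zero
  · exact fun h => h0 h.symm

/-- Up to its first arrival and the first ruin, each level rises linearly from zero. -/
lemma le_tau1 {m : ℝ} (hm : ∀ k, m ≤ θ k 1) : ENNReal.ofReal m ≤ tau1 M J := by
  by_contra! hlt
  have hτ : tau1 M J < ⊤ := hlt.trans ENNReal.ofReal_lt_top
  have hT0 := h.toReal_tau1_pos hτ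
  rw [← ofReal_tau1 hτ] at hlt
  have hTm := (ENNReal.ofReal_lt_ofReal_iff_of_nonneg hT0.le).1 hlt
  have h1 := h.level_eq_init (first M J) hT0.le (ofReal_tau1 hτ).le (hTm.le.trans (hm _))
  rw [h.level_first_tau1 hτ] at h1
  exact (mul_pos (M.init_pos _) hT0).ne h1

lemma level_second_pos (hne : level M J (second M J) (tau1 M J).toReal ≠ 0)
    {t : ℝ} (ht : 0 < t) (htτ : ENNReal.ofReal t ≤ tau1 M J) : 0 < level M J (second M J) t := by
  refine h.level_pos_of_forall_ne _ ht fun s hs => ?_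
  rcases ((ENNReal.ofReal_le_ofReal hs.2).trans htτ).lt_or_eq with hlt | heq
  · exact level_ne_zero_of_lt _ hs.1 hlt
  · rwa [← heq, ENNReal.toReal_ofReal hs.1.le] at hne

/-- A level that is not ruined at an arrival crosses zero when it first returns to it. -/
lemma exists_crossing (hτ : tau1 M J < ⊤) (hτ2 : tau2 M J < ⊤)
    (hne : level M J (second M J) (tau1 M J).toReal ≠ 0)
    (hθ : ∀ n, level M J (second M J) (θ (second M J) (n + 1)) ≠ 0) :
    ∃ T, (tau1 M J).toReal < T ∧ (∀ t ∈ Set.Ioo 0 T, 0 < level M J (second M J) t) ∧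
      ∃ U > T, ∀ t ∈ Set.Ioc T U, level M J (second M J) t < 0 := by
  set b := second M J with hb
  set R := (tau1 M J).toReal with hR
  have hR0 : 0 < R := h.toReal_tau1_pos hτ
  obtain ⟨z, hz, hz0⟩ : ∃ z, 0 < z ∧ level M J b z = 0 := by
    obtain ⟨s, ⟨-, s₁, h₁, s₂, h₂, h3, h4⟩, -⟩ := exists_mem_of_infTime_lt hτ2
    obtain hb0 | hb0 : b = 0 ∨ b = 1 := by omega
    · exact ⟨s₁, h₁.1, hb0 ▸ h3⟩
    · exact ⟨s₂, h₂.1, hb0 ▸ h4⟩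
  have hpos : ∀ t, 0 < t → t ≤ R → 0 < level M J b t := fun t ht htR =>
    h.level_second_pos hne ht (by
      rw [← ofReal_tau1 hτ]; exact ENNReal.ofReal_le_ofReal htR)
  set Z : Set ℝ := Set.Ici R ∩ level M J b ⁻¹' {0} with hZ
  have hZc : IsClosed Z := ((h.continuousOn_level b).mono
    (Set.Ici_subset_Ici.2 hR0.le)).preimage_isClosed_of_isClosed isClosed_Ici isClosed_singleton
  have hZne : Z.Nonempty := ⟨z, le_of_not_gt fun hzR => (hpos z hz hzR.le).ne' hz0, hz0⟩
  have hZb : BddBelow Z := ⟨R, fun _ h => h.1⟩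
  have hTZ := hZc.csInf_mem hZne hZb
  set T := sInf Z with hT
  have hT0 : level M J b T = 0 := hTZ.2
  have hRT : R < T := lt_of_le_of_ne hTZ.1 fun hRT => hne (by rw [hRT]; exact hT0)
  have hposT : ∀ t ∈ Set.Ioo 0 T, 0 < level M J b t := fun t ht =>
    h.level_pos_of_forall_ne b ht.1 fun s hs hs0 => by
      rcases le_or_gt s R with hsR | hsR
      · exact (hpos s hs.1 hsR).ne' hs0
      · exact (csInf_le hZb (show s ∈ Z from ⟨hsR.le, hs0⟩)).not_gt (hs.2.trans_lt ht.2)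
  refine ⟨T, hRT, hposT, ?_⟩
  obtain ⟨n, hn1, hn2⟩ := h.exists_mem_Ico b (hR0.trans hRT).le
  have hn1' : θ b n < T := by
    refine lt_of_le_of_ne hn1 fun heq => ?_
    rcases n with _ | n
    · rw [h.zero] at heq; linarith
    · exact hθ n (by rw [heq]; exact hT0)
  -- The linear piece containing `T` starts at the last arrival or at the switch, whichever is
  -- later. It begins strictly before `T` at a positive value, so its slope is negative, and it
  -- continues past `T` to the next arrival.
  set s := max R (θ b n) with hs
  have hsT : s < T := max_lt hRT hn1'
  have hs0 : 0 < s := hR0.trans_le (le_max_left _ _)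
  have hlin : ∀ t, s ≤ t → t ≤ θ b (n + 1) →
      level M J b t = level M J b s + M.rate b (J b s) * (t - s) := fun t h1 h2 =>
    h.level_eq_add b hs0.le h1 (h.notMem_Ioo b (le_max_right _ _) h2) fun hh => by
      rw [← ofReal_tau1 hτ] at hh
      exact hh.1.not_ge (ENNReal.ofReal_le_ofReal (le_max_left _ _))
  have hFs := hposT s ⟨hs0, hsT⟩
  have hFT := hlin T hsT.le hn2.le
  rw [hT0] at hFT
  have hc : M.rate b (J b s) < 0 := by
    by_contra! hc
    have := mul_nonneg hc (sub_pos.2 hsT).le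
    linarith
  refine ⟨θ b (n + 1), hn2, fun t ht => ?_⟩
  rw [hlin t (hsT.trans ht.1).le ht.2]
  nlinarith [mul_pos_of_neg_of_neg hc (sub_neg.2 ht.1)]

lemma tau2_le_of_neg (hτ : tau1 M J < ⊤)
    (hne : level M J (second M J) (tau1 M J).toReal ≠ 0) {u : ℝ} (hu : 0 < u)
    (hneg : level M J (second M J) u < 0) : tau2 M J ≤ ENNReal.ofReal u := by
  obtain ⟨s, hs, hs0⟩ := h.exists_zero_of_neg _ hu hneg
  have hR : (tau1 M J).toReal < u := by
    by_contra! hle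
    have := h.level_second_pos hne hu (by
      rw [← ofReal_tau1 hτ]; exact ENNReal.ofReal_le_ofReal hle)
    linarith
  have h1 : (tau1 M J).toReal ∈ Set.Ioc 0 u := ⟨h.toReal_tau1_pos hτ, hR.le⟩
  have h2 : s ∈ Set.Ioc 0 u := ⟨hs.1, hs.2.le⟩
  have h3 := h.level_first_tau1 hτ
  have h4 := second_ne_first (M := M) (J := J)
  refine infTime_le ⟨hu, ?_⟩
  obtain h5 | h5 : first M J = 0 ∨ first M J = 1 := by omega
  · have h6 : second M J = 1 := by omega
    exact ⟨_, h1, s, h2, h5 ▸ h3, h6 ▸ hs0⟩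
  · have h6 : second M J = 0 := by omega
    exact ⟨s, h2, _, h1, h6 ▸ hs0, h5 ▸ h3⟩

omit h in
lemma le_tau2_of_pos (k : Fin 2) {v : ℝ} (hpos : ∀ t ∈ Set.Ioo 0 v, 0 < level M J k t) :
    ENNReal.ofReal v ≤ tau2 M J := by
  refine le_iInf₂ fun s hs => ENNReal.ofReal_le_ofReal ?_
  obtain ⟨-, s₁, h₁, s₂, h₂, h3, h4⟩ := hs
  by_contra! hlt
  obtain rfl | rfl : k = 0 ∨ k = 1 := by omega
  · exact (hpos s₁ ⟨h₁.1, h₁.2.trans_lt hlt⟩).ne' h3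
  · exact (hpos s₂ ⟨h₂.1, h₂.2.trans_lt hlt⟩).ne' h4

end RegularPath

end Path

lemma edist_ofReal_ofReal {x y : ℝ} (hx : 0 ≤ x) (hy : 0 ≤ y) :
    edist (ENNReal.ofReal x) (ENNReal.ofReal y) = ENNReal.ofReal |x - y| := by
  have h1 : edist (ENNReal.ofReal x) (ENNReal.ofReal y) = edist x.toNNReal y.toNNReal := rfl
  rw [h1, edist_dist, NNReal.dist_eq, Real.coe_toNNReal _ hx, Real.coe_toNNReal _ hy]

lemma exists_firstIndex_eq {p : ℕ → Prop} {n : ℕ} (hn : 1 ≤ n) (hp : p n) :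
    ∃ m : ℕ, firstIndex p = m ∧ 1 ≤ m ∧ m ≤ n ∧ p m := by
  classical
  have hex : ∃ n, 1 ≤ n ∧ p n := ⟨n, hn, hp⟩
  refine ⟨Nat.find hex, le_antisymm (iInf₂_le
    (f := fun (n : ℕ) (_ : n ∈ {n : ℕ | 1 ≤ n ∧ p n}) => (n : ℕ∞)) _ (Nat.find_spec hex)) ?_,
    (Nat.find_spec hex).1, Nat.find_min' hex ⟨hn, hp⟩, (Nat.find_spec hex).2⟩
  exact le_iInf₂ fun m hm => by exact_mod_cast Nat.find_min' hex hm

/-! ### Deterministic paths: error of the pasting on a regular grid -/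

section Path

variable {E S : Fin 2 → Type*} [∀ k, Fintype (E k)] [∀ k, Fintype (S k)]
  {M : Params E S} {J : ∀ k, ℝ → E k ⊕ S k} {θ g : Fin 2 → ℕ → ℝ}

namespace RegularPath

variable (h : RegularPath M J θ)
include h

lemma jumpIndex_spec (k : Fin 2) : θ k (jumpIndex M J θ k) ≤ (tau1 M J).toReal ∧
    (tau1 M J).toReal < θ k (jumpIndex M J θ k + 1) :=
  Nat.sInf_mem (s := {l | θ k l ≤ (tau1 M J).toReal ∧ (tau1 M J).toReal < θ k (l + 1)})
    (h.exists_mem_Ico k ENNReal.toReal_nonneg)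

/-- From the first ruin time to the next arrival the environment keeps its value at the switch, so
the third branch of the pasting also agrees with `J`. Only the interval between ruin and switching
time can differ. -/
lemma pastedEnv_eq (hτ : tau1 M J < ⊤) (k : Fin 2) {t : ℝ}
    (ht : t ∉ Set.Ico (min (tau1 M J).toReal (sigma M J θ g k))
      (max (tau1 M J).toReal (sigma M J θ g k))) : pastedEnv M J θ g k t = J k t := by
  have hs := h.jumpIndex_spec k
  unfold pastedEnv
  split_ifs with h1 h2 h3
  · rfl
  · exact absurd ⟨not_lt.1 h1, h2.trans_le (le_max_right _ _)⟩ ht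
  · have h4 : (tau1 M J).toReal ≤ t := by
      by_contra! hlt
      exact ht ⟨not_lt.1 h1, hlt.trans_le (le_max_left _ _)⟩
    refine h.const k _ t ENNReal.toReal_nonneg h4 (fun n hn => ?_) fun hh => ?_
    · have h5 := (h.strictMono k).lt_iff_lt.1 (hs.1.trans_lt hn.1)
      have h6 := (h.strictMono k).lt_iff_lt.1 (hn.2.trans_lt h3)
      omega
    · rw [ofReal_tau1 hτ] at hh
      exact hh.1.false
  · rfl

lemma exists_pastedEnv_eq_const (k : Fin 2) :
    ∃ x, ∀ t ∈ Set.Ico (min (tau1 M J).toReal (sigma M J θ g k))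
      (max (tau1 M J).toReal (sigma M J θ g k)), pastedEnv M J θ g k t = x := by
  have hs := h.jumpIndex_spec k
  rcases le_total (sigma M J θ g k) (tau1 M J).toReal with hle | hle
  · refine ⟨J k (tau1 M J).toReal, fun t ht => ?_⟩
    rw [min_eq_right hle, max_eq_left hle] at ht
    unfold pastedEnv
    rw [min_eq_right hle, if_neg (not_lt.2 ht.1), if_neg (not_lt.2 ht.1), if_pos (ht.2.trans hs.2)]
  · refine ⟨leftValue (J k) (tau1 M J).toReal, fun t ht => ?_⟩
    rw [min_eq_left hle, max_eq_right hle] at ht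
    unfold pastedEnv
    rw [min_eq_left hle, if_neg (not_lt.2 ht.1), if_pos ht.2]

lemma intervalIntegrable_pasted (hτ : tau1 M J < ⊤) (k : Fin 2) {t : ℝ} (ht : 0 ≤ t) :
    IntervalIntegrable (fun x => M.rate k (pastedEnv M J θ g k x)) volume 0 t := by
  obtain ⟨f, hf, hfJ⟩ := h.exists_measurable_rate k
  obtain ⟨C, -, hC⟩ := M.exists_rate_bound
  obtain ⟨x₀, hx₀⟩ := h.exists_pastedEnv_eq_const (g := g) k
  have hm : Measurable (fun x => open Classical in
      if x ∈ Set.Ico (min (tau1 M J).toReal (sigma M J θ g k))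
      (max (tau1 M J).toReal (sigma M J θ g k)) then M.rate k x₀ else f x) :=
    Measurable.ite measurableSet_Ico measurable_const hf
  have : IntervalIntegrable (fun _ : ℝ => C) volume 0 t := intervalIntegrable_const
  refine this.mono_fun (hm.aestronglyMeasurable.congr ?_) ?_
  · filter_upwards [ae_restrict_mem measurableSet_uIoc] with x hx
    rw [Set.uIoc_of_le ht] at hx
    split_ifs with hxI
    · rw [hx₀ x hxI]
    · rw [h.pastedEnv_eq hτ k hxI, hfJ x hx.1.le]
  · exact ae_of_all _ fun x => (hC k _).trans (le_abs_self C)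

/-- The two rates differ by at most `2 * C`, and only between the two switching times. -/
lemma abs_pastedLevel_sub_le (hτ : tau1 M J < ⊤) {C : ℝ} (hC : ∀ k x, |M.rate k x| ≤ C)
    (k : Fin 2) {t : ℝ} (ht : 0 ≤ t) : |pastedLevel M J θ g k t - level M J k t|
      ≤ 2 * C * |sigma M J θ g k - (tau1 M J).toReal| := by
  set I := Set.Ico (min (tau1 M J).toReal (sigma M J θ g k))
      (max (tau1 M J).toReal (sigma M J θ g k)) with hI
  set f := fun x => M.rate k (pastedEnv M J θ g k x) - M.rate k (J k x) with hf
  have hC0 : 0 ≤ C := (abs_nonneg _).trans (hC 0 (.inl (M.init 0)))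
  have h1 : pastedLevel M J θ g k t - level M J k t = ∫ x in Set.Ioc 0 t ∩ I, f x := by
    rw [← setIntegral_indicator measurableSet_Ico, ← intervalIntegral.integral_of_le ht]
    unfold pastedLevel level
    rw [← intervalIntegral.integral_sub (h.intervalIntegrable_pasted hτ k ht)
      (h.intervalIntegrable k le_rfl ht)]
    congr 1
    funext x
    by_cases hx : x ∈ I
    · rw [Set.indicator_of_mem hx]
    · rw [Set.indicator_of_notMem hx, h.pastedEnv_eq hτ k hx, sub_self]
  have hvol : volume.real (Set.Ioc 0 t ∩ I) ≤ |sigma M J θ g k - (tau1 M J).toReal| := by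
    refine (measureReal_mono Set.inter_subset_right measure_Ico_lt_top.ne).trans ?_
    rw [Real.volume_real_Ico, max_sub_min_eq_abs', abs_sub_comm, max_eq_left (abs_nonneg _)]
  rw [h1]
  have h2 : ‖∫ x in Set.Ioc 0 t ∩ I, f x‖ ≤ 2 * C * volume.real (Set.Ioc 0 t ∩ I) := by
    refine norm_setIntegral_le_of_norm_le_const
      (measure_lt_top_of_subset Set.inter_subset_right measure_Ico_lt_top.ne) fun x _ => ?_
    refine (norm_sub_le _ _).trans ?_
    have := hC k (pastedEnv M J θ g k x)
    have := hC k (J k x)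
    simp only [Real.norm_eq_abs]
    linarith
  exact h2.trans (mul_le_mul_of_nonneg_left hvol (by positivity))

lemma pastedLevel_eq (hτ : tau1 M J < ⊤) (k : Fin 2) {t : ℝ} (ht : 0 ≤ t)
    (htm : t ≤ min (tau1 M J).toReal (sigma M J θ g k)) :
    pastedLevel M J θ g k t = level M J k t := by
  unfold pastedLevel level
  rw [intervalIntegral.integral_of_le ht, intervalIntegral.integral_of_le ht,
      ← integral_Ico_eq_integral_Ioc, ← integral_Ico_eq_integral_Ioc]
  exact setIntegral_congr_fun measurableSet_Ico fun x hx => by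
    simp only [h.pastedEnv_eq hτ k fun hxI => hxI.1.not_gt (hx.2.trans_le htm)]

/-- One index `l` serves both components, and both grids are close to `l / γ`, so both candidate
times are near the first ruin time. An incompatible pasting has error zero, hence compatibility need
not be shown to be likely. -/
lemma exists_ellStar_eq (hτ : tau1 M J < ⊤) {γ δ T : ℝ} (hγ : 0 < γ) (hγδ : 1 ≤ γ * δ)
    (hT : (tau1 M J).toReal + 2 * δ ≤ T) (hg : ∀ k, GridClose γ T δ (g k)) :
    ∃ l : ℕ, ellStar M J g = l ∧ |l / γ - (tau1 M J).toReal| ≤ 2 * δ ∧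
      ∀ k, |sigma M J θ g k - (tau1 M J).toReal| ≤ 3 * δ := by
  set R := (tau1 M J).toReal with hR
  have hR0 : 0 < R := h.toReal_tau1_pos hτ
  have hδ : 0 < δ := pos_of_mul_pos_right (by linarith) hγ.le
  -- Here `n / γ` lies in `(R + δ, R + 2 * δ]`, so the `n`-th grid point exceeds `R` despite its
  -- error `δ`.
  set n := ⌊γ * (R + δ)⌋₊ + 1 with hn
  have hn1 : γ * (R + δ) < n := by rw [hn]; push_cast; exact Nat.lt_floor_add_one _
  have hn2 : (n : ℝ) ≤ γ * (R + 2 * δ) := by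
    have : (⌊γ * (R + δ)⌋₊ : ℝ) ≤ γ * (R + δ) := Nat.floor_le (by positivity)
    rw [hn]; push_cast; linarith
  have hnT : (n : ℝ) ≤ γ * T := hn2.trans (mul_le_mul_of_nonneg_left hT hγ.le)
  have hn3 : R + δ < n / γ := by rw [lt_div_iff₀ hγ]; linarith
  have hn4 : (n : ℝ) / γ ≤ R + 2 * δ := by rw [div_le_iff₀ hγ]; linarith
  have hgn := abs_le.1 (hg (first M J) n hnT)
  obtain ⟨l, hl, hl1, hln, hlt⟩ := exists_firstIndex_eq
    (p := fun ℓ => tau1 M J < ENNReal.ofReal (g (first M J) ℓ)) (n := n) (by omega) (by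
      rw [← ofReal_tau1 hτ]
      exact (ENNReal.ofReal_lt_ofReal_iff (by linarith)).2 (by linarith))
  have hln' : (l : ℝ) ≤ n := by exact_mod_cast hln
  have hlT := hln'.trans hnT
  have hgl := fun k => abs_le.1 (hg k l hlT)
  have hl4 : (l : ℝ) / γ ≤ R + 2 * δ := (div_le_div_of_nonneg_right hln' hγ.le).trans hn4
  have hl5 : R < g (first M J) l := by
    rw [← ofReal_tau1 hτ] at hlt
    exact (ENNReal.ofReal_lt_ofReal_iff_of_nonneg hR0.le).1 hlt
  have hl6 := hgl (first M J)
  refine ⟨l, hl, abs_le.2 ⟨by linarith, by linarith⟩, fun k => ?_⟩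
  unfold sigma
  split_ifs
  · have hs : sigmaStar M J g k = ENNReal.ofReal (g k l) := by
      have : ellStar M J g = l := hl
      rw [sigmaStar, this]; rfl
    rw [hs, ENNReal.toReal_ofReal']
    have := hgl k
    rw [abs_le]
    rcases max_cases (g k l) 0 with h | h <;> constructor <;> linarith
  · rw [sub_self, abs_zero]; positivity

/-- On a sufficiently regular grid, the approximate ruin times and the rescaled indices are close
to the ruin times. -/
lemma edist_approx_le (hτ : tau1 M J < ⊤)
    (hne : level M J (second M J) (tau1 M J).toReal ≠ 0) {C : ℝ} (hC : ∀ k x, |M.rate k x| ≤ C)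
    {γ δ T η m u ε : ℝ} (hm : ∀ k, m ≤ θ k 1) (hu : 0 < u)
    (hlow : level M J (second M J) u ≤ -η)
    (hhigh : ∀ q, m / 2 ≤ q → q ≤ u - 2 * ε → η ≤ level M J (second M J) q)
    (hγ : 0 < γ) (hγδ : 1 ≤ γ * δ) (hT : u + 3 * δ ≤ T) (hg : ∀ k, GridClose γ T δ (g k))
    (hg0 : ∀ k n, 0 ≤ g k n)
    (hδm : 6 * δ ≤ m) (hδη : 9 * C * δ < η) (hδε : 3 * δ ≤ ε) :
    max (edist (approxTau1 M J θ g) (tau1 M J)) (edist (approxTau2 M J θ g) (tau2 M J))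
        ≤ ENNReal.ofReal (3 * ε) ∧
      max (edist ((ellStar M J g : ℝ≥0∞) / ENNReal.ofReal γ) (tau1 M J))
        (edist ((nStar M J θ g : ℝ≥0∞) / ENNReal.ofReal γ) (tau2 M J))
        ≤ ENNReal.ofReal (3 * ε) := by
  set b := second M J with hb
  set R := (tau1 M J).toReal with hR
  have hR0 : 0 < R := h.toReal_tau1_pos hτ
  have hδ : 0 < δ := pos_of_mul_pos_right (by linarith) hγ.le
  have hC0 : 0 ≤ C := (abs_nonneg _).trans (hC 0 (.inl (M.init 0)))
  have hCδ : 0 ≤ C * δ := mul_nonneg hC0 hδ.le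
  have hη : 0 < η := by linarith
  have hpos : ∀ t, 0 < t → t ≤ R → 0 < level M J b t := fun t ht htR =>
    h.level_second_pos hne ht (by
      rw [← ofReal_tau1 hτ]; exact ENNReal.ofReal_le_ofReal htR)
  have hRu : R < u := by
    by_contra! hle
    linarith [hpos u hu hle]
  have hmR : m ≤ R := by
    have := h.le_tau1 hm
    rw [← ofReal_tau1 hτ] at this
    exact (ENNReal.ofReal_le_ofReal_iff hR0.le).1 this
  have hτ2u : tau2 M J ≤ ENNReal.ofReal u := h.tau2_le_of_neg hτ hne hu (by linarith)
  have hτ2l : ENNReal.ofReal (u - 2 * ε) ≤ tau2 M J := le_tau2_of_pos b fun t ht => by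
    rcases le_total t R with htR | htR
    · exact hpos t ht.1 htR
    · linarith [hhigh t (by linarith) ht.2.le]
  set R₂ := (tau2 M J).toReal with hR₂
  have hR₂0 : 0 ≤ R₂ := ENNReal.toReal_nonneg
  have hτ2 : tau2 M J = ENNReal.ofReal R₂ :=
    (ENNReal.ofReal_toReal (hτ2u.trans_lt ENNReal.ofReal_lt_top).ne).symm
  have hR₂u : R₂ ≤ u := by
    rw [hτ2] at hτ2u; exact (ENNReal.ofReal_le_ofReal_iff hu.le).1 hτ2u
  have hR₂l : u - 2 * ε ≤ R₂ := by
    rw [hτ2] at hτ2l; exact (ENNReal.ofReal_le_ofReal_iff hR₂0).1 hτ2l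
  obtain ⟨l, hl, hlR, hσ⟩ := h.exists_ellStar_eq hτ hγ hγδ (by linarith) hg
  have hpast : ∀ t, 0 ≤ t → |pastedLevel M J θ g b t - level M J b t| ≤ 6 * C * δ := fun t ht => by
    refine (h.abs_pastedLevel_sub_le hτ hC b ht).trans ?_
    have := mul_le_mul_of_nonneg_left (hσ b) (by positivity : 0 ≤ 2 * C)
    linarith
  set n := ⌊γ * (u + δ)⌋₊ + 1 with hn
  have hn1 : γ * (u + δ) < n := by rw [hn]; push_cast; exact Nat.lt_floor_add_one _
  have hn2 : (n : ℝ) ≤ γ * (u + 2 * δ) := by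
    have : (⌊γ * (u + δ)⌋₊ : ℝ) ≤ γ * (u + δ) := Nat.floor_le (by positivity)
    rw [hn]; push_cast; linarith
  have hnT : (n : ℝ) ≤ γ * T := hn2.trans (mul_le_mul_of_nonneg_left (by linarith) hγ.le)
  have hn3 : u + δ < n / γ := by rw [lt_div_iff₀ hγ]; linarith
  have hn4 : (n : ℝ) / γ ≤ u + 2 * δ := by rw [div_le_iff₀ hγ]; linarith
  have hgn := abs_le.1 (hg b n hnT)
  -- The margin `η` must absorb `6 * C * δ` from the pasting and `3 * C * δ` from moving from `u` to
  -- the grid point; this is the condition `9 * C * δ < η`.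
  have hneg : pastedLevel M J θ g b (g b n) < 0 := by
    have h1 := (abs_le.1 (hpast _ (hg0 b n))).2
    have h2 := (abs_le.1 (h.abs_level_sub_le hC b hu.le (hg0 b n))).2
    have h3 : C * |g b n - u| ≤ C * (3 * δ) :=
      mul_le_mul_of_nonneg_left (abs_le.2 ⟨by linarith, by linarith⟩) hC0
    linarith
  obtain ⟨j, hj, -, hjn, hjneg⟩ := exists_firstIndex_eq
    (p := fun n => pastedLevel M J θ g b (g b n) < 0) (n := n) (by omega) hneg
  have hjn' : (j : ℝ) ≤ n := by exact_mod_cast hjn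
  have hgj := abs_le.1 (hg b j (hjn'.trans hnT))
  have hj4 : (j : ℝ) / γ ≤ u + 2 * δ := (div_le_div_of_nonneg_right hjn' hγ.le).trans hn4
  have hju : u - 2 * ε ≤ g b j := by
    by_contra! hlt
    -- Near time zero there is no margin. But `6 * δ ≤ m` keeps both the ruin time and the switching
    -- time beyond `m / 2`, so there the pasted level equals the true one, which is nonnegative.
    rcases lt_or_ge (g b j) (m / 2) with hjm | hjm
    · have h1 := (abs_le.1 (hσ b)).1
      rw [h.pastedLevel_eq hτ b (hg0 b j) (le_min (by linarith) (by linarith))] at hjneg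
      rcases (hg0 b j).eq_or_lt with h0 | h0
      · rw [← h0, level_zero] at hjneg
        exact hjneg.false
      · linarith [hpos _ h0 (by linarith)]
    · have h1 := (abs_le.1 (hpast _ (hg0 b j))).1
      linarith [hhigh _ hjm hlt.le]
  have hj' : nStar M J θ g = j := hj
  have hσ0 : 0 ≤ sigma M J θ g (first M J) := by
    have := (abs_le.1 (hσ (first M J))).1
    linarith
  have e1 : approxTau1 M J θ g = ENNReal.ofReal (sigma M J θ g (first M J)) := rfl
  have e2 : approxTau2 M J θ g = ENNReal.ofReal (g b j) := by
    rw [approxTau2, hj']; rfl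
  have e3 : ∀ i : ℕ, (((i : ℕ∞) : ℝ≥0∞)) / ENNReal.ofReal γ = ENNReal.ofReal (i / γ) := fun i => by
    rw [ENNReal.ofReal_div_of_pos hγ, ENNReal.ofReal_natCast]; rfl
  rw [hl, hj', e1, e2, e3, e3, hτ2, ← ofReal_tau1 hτ, ← hR, edist_ofReal_ofReal hσ0 hR0.le,
    edist_ofReal_ofReal (hg0 b j) hR₂0, edist_ofReal_ofReal (by positivity) hR0.le,
    edist_ofReal_ofReal (by positivity) hR₂0]
  refine ⟨max_le ?_ ?_, max_le ?_ ?_⟩ <;> refine ENNReal.ofReal_le_ofReal ?_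
  · linarith [hσ (first M J)]
  · rw [abs_le]; constructor <;> linarith
  · linarith
  · rw [abs_le]; constructor <;> linarith

end RegularPath

end Path

/-! ### Independence and fields generated by random variables -/

section Independence


/-- Intersections `s ∩ t` form a π-system generating `m₁ ⊔ m₂`, and on it the probability factors in
two stages. -/
lemma indep_sup_right {Ω : Type*} {m₁ m₂ m₃ mΩ : MeasurableSpace Ω} {P : Measure Ω}
    [IsProbabilityMeasure P] (h₁ : m₁ ≤ mΩ)
    (h₂ : m₂ ≤ mΩ) (h₃ : m₃ ≤ mΩ) (h23 : Indep m₂ m₃ P) (h1 : Indep m₁ (m₂ ⊔ m₃) P) :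
    Indep m₃ (m₁ ⊔ m₂) P := by
  set p : Set (Set Ω) :=
    Set.image2 (· ∩ ·) {s | MeasurableSet[m₁] s} {t | MeasurableSet[m₂] t} with hp
  refine IndepSets.indep (p1 := {s | MeasurableSet[m₃] s}) (p2 := p) h₃ (sup_le h₁ h₂)
    (@MeasurableSpace.isPiSystem_measurableSet _ m₃) ?_
    (@MeasurableSpace.generateFrom_measurableSet _ m₃).symm ?_ ?_
  · rintro _ ⟨s, hs, t, ht, rfl⟩ _ ⟨s', hs', t', ht', rfl⟩ -
    exact ⟨s ∩ s', MeasurableSet.inter hs hs', t ∩ t', MeasurableSet.inter ht ht',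
      Set.inter_inter_inter_comm _ _ _ _⟩
  · refine le_antisymm (sup_le (fun s hs => ?_) fun t ht => ?_)
      (MeasurableSpace.generateFrom_le ?_)
    · exact MeasurableSpace.measurableSet_generateFrom
        ⟨s, hs, Set.univ, MeasurableSet.univ, Set.inter_univ _⟩
    · exact MeasurableSpace.measurableSet_generateFrom
        ⟨Set.univ, MeasurableSet.univ, t, ht, Set.univ_inter _⟩
    · rintro _ ⟨s, hs, t, ht, rfl⟩
      exact MeasurableSet.inter ((le_sup_left : m₁ ≤ m₁ ⊔ m₂) s hs)
        ((le_sup_right : m₂ ≤ m₁ ⊔ m₂) t ht)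
  · rw [IndepSets_iff]
    rintro u _ hu ⟨s, hs, t, ht, rfl⟩
    have e1 := (Indep_iff _ _ _).1 h23 t u ht hu
    have e2 := (Indep_iff _ _ _).1 h1 s (t ∩ u) hs (MeasurableSet.inter
      ((le_sup_left : m₂ ≤ m₂ ⊔ m₃) t ht) ((le_sup_right : m₃ ≤ m₂ ⊔ m₃) u hu))
    have e3 := (Indep_iff _ _ _).1 h1 s t hs ((le_sup_left : m₂ ≤ m₂ ⊔ m₃) t ht)
    change P (u ∩ (s ∩ t)) = P u * P (s ∩ t)
    rw [e3, show u ∩ (s ∩ t) = s ∩ (t ∩ u) by ext; simp; tauto, e2, e1]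
    ring

/-- By Fubini the diagonal is null for the product law, since each of its slices is a single point
without mass. -/
lemma measure_eq_of_indep {Ω : Type*} {m mΩ : MeasurableSpace Ω} {P : Measure Ω}
    [IsProbabilityMeasure P] (hm : m ≤ mΩ)
    {Y Z : Ω → ℝ} (hY : Measurable Y) (hYm : Indep (MeasurableSpace.comap Y inferInstance) m P)
    (hatom : ∀ x, P.map Y {x} = 0) (hZ : Measurable[m] Z) : P {ω | Y ω = Z ω} = 0 := by
  have hZ' : Measurable Z := hZ.mono hm le_rfl
  have hind : IndepFun Y Z P := indep_of_indep_of_le_right hYm hZ.comap_le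
  have hlaw := (indepFun_iff_map_prod_eq_prod_map_map hY.aemeasurable hZ'.aemeasurable).1 hind
  have hD : MeasurableSet {p : ℝ × ℝ | p.1 = p.2} := measurableSet_eq_fun measurable_fst measurable_snd
  have h1 : P {ω | Y ω = Z ω} = P.map (fun ω => (Y ω, Z ω)) {p : ℝ × ℝ | p.1 = p.2} := by
    rw [Measure.map_apply (hY.prodMk hZ') hD]; rfl
  have := Measure.isProbabilityMeasure_map (μ := P) hY.aemeasurable
  have := Measure.isProbabilityMeasure_map (μ := P) hZ'.aemeasurable
  rw [h1, hlaw, Measure.prod_apply_symm hD]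
  simp only [Set.preimage_ofPred_eq, Set.ofPred_eq_eq_singleton, hatom, lintegral_zero]

lemma exists_polynomial_of_mem_subring_closure {ι : Type*} {v : ι → ℝ} {x : ℝ}
    (hx : x ∈ Subring.closure (Set.range v)) : ∃ p : MvPolynomial ι ℤ, MvPolynomial.aeval v p = x := by
  have : Subring.closure (Set.range v) ≤ (MvPolynomial.aeval (R := ℤ) v).toRingHom.range :=
    Subring.closure_le.2 (by
      rintro _ ⟨i, rfl⟩
      exact ⟨MvPolynomial.X i, MvPolynomial.aeval_X v i⟩)
  exact this hx

lemma measurable_aeval {Ω ι : Type*} {m : MeasurableSpace Ω} {X : ι → Ω → ℝ}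
    (hX : ∀ i, Measurable[m] (X i)) (p : MvPolynomial ι ℤ) :
    Measurable[m] fun ω => MvPolynomial.aeval (fun i => X i ω) p := by
  induction p using MvPolynomial.induction_on with
  | C a => simp only [MvPolynomial.aeval_C]; exact measurable_const
  | add p q hp hq => simp only [map_add]; exact hp.add hq
  | mul_X p i hp => simp only [map_mul, MvPolynomial.aeval_X]; exact hp.mul (hX i)

/-- A random variable with a diffuse law does not belong to the field generated by countably many
random variables that are independent of it. -/
lemma ae_notMem_subfield_closure {Ω : Type*} {m mΩ : MeasurableSpace Ω} {P : Measure Ω}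
    [IsProbabilityMeasure P] (hm : m ≤ mΩ)
    {Y : Ω → ℝ} (hY : Measurable Y) (hYm : Indep (MeasurableSpace.comap Y inferInstance) m P)
    (hatom : ∀ x, P.map Y {x} = 0) {ι : Type*} [Countable ι] {X : ι → Ω → ℝ}
    (hX : ∀ i, Measurable[m] (X i)) :
    ∀ᵐ ω ∂P, Y ω ∉ Subfield.closure (Set.range fun i => X i ω) := by
  have hcount : Countable (MvPolynomial ι ℤ) := by
    rw [← Cardinal.mk_le_aleph0_iff]
    exact MvPolynomial.cardinalMk_le_max_lift.trans (by simp)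
  -- Every element of the generated field is a quotient of values of two integer polynomials, and
  -- there are countably many such pairs. A vanishing denominator gives the value `0`, which keeps
  -- the quotient measurable.
  have h : ∀ q : MvPolynomial ι ℤ × MvPolynomial ι ℤ, ∀ᵐ ω ∂P,
      Y ω ≠ MvPolynomial.aeval (fun i => X i ω) q.1 / MvPolynomial.aeval (fun i => X i ω) q.2 := by
    intro q
    rw [ae_iff]
    simp only [not_not]
    exact measure_eq_of_indep hm hY hYm hatom ((measurable_aeval hX q.1).div (measurable_aeval hX q.2))
  filter_upwards [ae_all_iff.2 h] with ω hω hmem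
  obtain ⟨y, hy, z, hz, hyz⟩ := Subfield.mem_closure_iff.1 hmem
  obtain ⟨p, rfl⟩ := exists_polynomial_of_mem_subring_closure hy
  obtain ⟨q, rfl⟩ := exists_polynomial_of_mem_subring_closure hz
  exact hω (p, q) hyz.symm

variable {Ω : Type*} [mΩ : MeasurableSpace Ω] {P : Measure Ω}

lemma IsPoissonArrivals.measurable_gap {c : ℝ} {θ : ℕ → Ω → ℝ} (h : IsPoissonArrivals P c θ)
    (n : ℕ) : Measurable fun ω => θ (n + 1) ω - θ n ω := (h.measurable _).sub (h.measurable _)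

/-- An interarrival time of a Poisson process is transcendental over what is generated by the other
interarrival times, an independent sequence and countably many constants. -/
lemma IsPoissonArrivals.ae_gap_notMem_closure [IsProbabilityMeasure P] {c : ℝ} {θ : ℕ → Ω → ℝ}
    (h : IsPoissonArrivals P c θ) {Z : ℕ → Ω → ℝ} (hZ : ∀ n, Measurable (Z n))
    (hind : IndepFun (fun ω n => Z n ω) (fun ω n => θ n ω) P) {κ : Type*} [Countable κ]
    (v : κ → ℝ) (n : ℕ) : ∀ᵐ ω ∂P, θ (n + 1) ω - θ n ω ∉ Subfield.closure
      (Set.range v ∪ Set.range (fun i => Z i ω) ∪ {x | ∃ j ≠ n, x = θ (j + 1) ω - θ j ω}) := by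
  set Y : ℕ → Ω → ℝ := fun j ω => θ (j + 1) ω - θ j ω with hYdef
  have hYm : ∀ j, Measurable (Y j) := h.measurable_gap
  have hmle : ∀ j, MeasurableSpace.comap (Y j) inferInstance ≤ mΩ := fun j => (hYm j).comap_le
  have hmZle : MeasurableSpace.comap (fun ω n => Z n ω) inferInstance ≤ mΩ := (measurable_pi_lambda _ hZ).comap_le
  have h23 : Indep (⨆ j ∈ {j | j ≠ n}, MeasurableSpace.comap (Y j) inferInstance) ((MeasurableSpace.comap (Y n) inferInstance)) P := by
    have := indep_iSup_of_disjoint hmle (h.indep : iIndep (fun j => MeasurableSpace.comap (Y j) inferInstance) P) (S := {j | j ≠ n}) (T := {n})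
      (by simp)
    simpa using this
  have hle : ∀ j, MeasurableSpace.comap (Y j) inferInstance ≤ MeasurableSpace.comap (fun ω n => θ n ω) inferInstance := fun j => by
    refine Measurable.comap_le ?_
    have h1 : Measurable fun x : ℕ → ℝ => x (j + 1) - x j :=
      (measurable_pi_apply _).sub (measurable_pi_apply _)
    exact h1.comp (comap_measurable fun ω n => θ n ω)
  have hindep := indep_sup_right hmZle (iSup₂_le fun j _ => hmle j) (hmle n) h23
    (indep_of_indep_of_le_right hind (sup_le (iSup₂_le fun j _ => hle j) (hle n)))
  have hatom : ∀ x, P.map (Y n) {x} = 0 := fun x => by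
    rw [(h.law n).map_eq]; exact expMeasure_singleton c x
  have := ae_notMem_subfield_closure (sup_le hmZle (iSup₂_le fun j _ => hmle j)) (hYm n) hindep
    hatom (X := Sum.elim (fun k _ => v k) (Sum.elim Z fun j : {j // j ≠ n} => Y j)) (by
      rintro (k | i | j)
      · exact measurable_const
      · exact ((measurable_pi_apply i).comp (comap_measurable fun ω n => Z n ω)).mono
          le_sup_left le_rfl
      · exact (comap_measurable (Y j)).mono
          ((le_iSup₂ (f := fun j (_ : j ∈ {j | j ≠ n}) => MeasurableSpace.comap (Y j) inferInstance) j.1 j.2).trans le_sup_right) le_rfl)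
  filter_upwards [this] with ω hω
  refine fun hmem => hω (Subfield.closure_mono ?_ hmem)
  rintro x ((⟨k, rfl⟩ | ⟨i, rfl⟩) | ⟨j, hj, rfl⟩)
  · exact ⟨.inl k, rfl⟩
  · exact ⟨.inr (.inl i), rfl⟩
  · exact ⟨.inr (.inr ⟨j, hj⟩), rfl⟩

end Independence

/-! ### Ruin times and gaps as elements of generated fields -/

section Path

variable {E S : Fin 2 → Type*} [∀ k, Fintype (E k)] [∀ k, Fintype (S k)]
  {M : Params E S} {J : ∀ k, ℝ → E k ⊕ S k} {θ : Fin 2 → ℕ → ℝ}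

namespace RegularPath

variable (h : RegularPath M J θ)
include h

/-- Between two arrivals the slope can change only at the switch. The choice `s = θ k n` covers the
case without a switch inside, so one formula fits both. -/
lemma level_succ (k : Fin 2) (n : ℕ) : ∃ s x y, (s = θ k n ∨ s = (tau1 M J).toReal) ∧
    level M J k (θ k (n + 1)) = level M J k (θ k n) + M.rate k x * (s - θ k n)
      + M.rate k y * (θ k (n + 1) - s) := by
  have hle : θ k n ≤ θ k (n + 1) := (h.strictMono k).monotone n.le_succ
  by_cases hτ : ENNReal.ofReal (θ k n) < tau1 M J ∧ tau1 M J < ENNReal.ofReal (θ k (n + 1))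
  · have hfin : tau1 M J < ⊤ := hτ.2.trans_le le_top
    set R := (tau1 M J).toReal with hR
    have hR0 : 0 < R := h.toReal_tau1_pos hfin
    rw [← ofReal_tau1 hfin] at hτ
    have h1 : θ k n < R := (ENNReal.ofReal_lt_ofReal_iff hR0).1 hτ.1
    have h2 : R < θ k (n + 1) := (ENNReal.ofReal_lt_ofReal_iff_of_nonneg hR0.le).1 hτ.2
    refine ⟨R, J k (θ k n), J k R, Or.inr rfl, ?_⟩
    rw [← h.level_eq_add k (h.arrival_nonneg k n) h1.le (h.notMem_Ioo k le_rfl h2.le) fun hh =>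
        hh.2.ne (ofReal_tau1 hfin).symm]
    exact h.level_eq_add k hR0.le h2.le (h.notMem_Ioo k h1.le le_rfl) fun hh =>
        hh.1.ne (ofReal_tau1 hfin)
  · refine ⟨θ k n, J k (θ k n), J k (θ k n), Or.inl rfl, ?_⟩
    rw [h.level_eq_add k (h.arrival_nonneg k n) hle (h.notMem_Ioo k le_rfl le_rfl) hτ]
    ring

lemma level_arrival_mem {K : Subfield ℝ} (hK : ∀ k x, M.rate k x ∈ K) (k : Fin 2) {N : ℕ}
    (hθ : ∀ n ≤ N, θ k n ∈ K) (hR : (tau1 M J).toReal ∈ K) :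
    ∀ n ≤ N, level M J k (θ k n) ∈ K := by
  intro n
  induction n with
  | zero => intro _; rw [h.zero, level_zero]; exact K.zero_mem
  | succ n ih =>
    intro hn
    obtain ⟨s, x, y, hs, heq⟩ := h.level_succ k n
    have hsK : s ∈ K := by rcases hs with rfl | rfl; exacts [hθ n (by omega), hR]
    rw [heq]
    exact K.add_mem (K.add_mem (ih (by omega)) (K.mul_mem (hK k x)
      (K.sub_mem hsK (hθ n (by omega))))) (K.mul_mem (hK k y) (K.sub_mem (hθ _ hn) hsK))

lemma level_succ_of_le (k : Fin 2) (n : ℕ) (hτ : ENNReal.ofReal (θ k (n + 1)) ≤ tau1 M J) :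
    level M J k (θ k (n + 1)) = level M J k (θ k n)
      + M.rate k (J k (θ k n)) * (θ k (n + 1) - θ k n) :=
  h.level_eq_add k (h.arrival_nonneg k n) ((h.strictMono k).monotone n.le_succ)
    (h.notMem_Ioo k le_rfl le_rfl) fun hh => hh.2.not_ge hτ

lemma exists_level_tau1_eq (hτ : tau1 M J < ⊤) (k : Fin 2) :
    ∃ n, θ k n < (tau1 M J).toReal ∧ level M J k (tau1 M J).toReal = level M J k (θ k n)
      + M.rate k (J k (θ k n)) * ((tau1 M J).toReal - θ k n) := by
  obtain ⟨n, h1, h2⟩ := h.exists_mem_Ioc k (h.toReal_tau1_pos hτ)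
  exact ⟨n, h1, h.level_eq_add k (h.arrival_nonneg k n) h1.le (h.notMem_Ioo k le_rfl h2)
    fun hh => hh.2.ne (ofReal_tau1 hτ).symm⟩

/-- The first ruin time is generated by the arrival times of the component ruined first. -/
lemma tau1_mem {K : Subfield ℝ} (hK : ∀ k x, M.rate k x ∈ K) (k : Fin 2)
    (hθ : ∀ n, θ k n ∈ K) (hτ : tau1 M J < ⊤) (h0 : level M J k (tau1 M J).toReal = 0) :
    (tau1 M J).toReal ∈ K := by
  set R := (tau1 M J).toReal with hR
  -- Up to the ruin time no switch enters the increments, so these levels are expressed without `R`;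
  -- the last linear piece, of nonzero slope, is then solved for `R`.
  have hlev : ∀ n, ENNReal.ofReal (θ k n) ≤ tau1 M J → level M J k (θ k n) ∈ K := by
    intro n
    induction n with
    | zero => intro _; rw [h.zero, level_zero]; exact K.zero_mem
    | succ n ih =>
      intro hn
      rw [h.level_succ_of_le k n hn]
      exact K.add_mem (ih ((ENNReal.ofReal_le_ofReal
        ((h.strictMono k).monotone n.le_succ)).trans hn))
        (K.mul_mem (hK k _) (K.sub_mem (hθ _) (hθ _)))
  obtain ⟨n, hn, heq⟩ := h.exists_level_tau1_eq hτ k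
  have hle : ENNReal.ofReal (θ k n) ≤ tau1 M J := by
    rw [← ofReal_tau1 hτ]; exact ENNReal.ofReal_le_ofReal hn.le
  rw [h0] at heq
  have hne := M.rate_ne_zero k (J k (θ k n))
  have : R = θ k n - level M J k (θ k n) / M.rate k (J k (θ k n)) := by
    field_simp
    linarith
  rw [this]
  exact K.sub_mem (hθ n) (K.div_mem (hlev n hle) (hK k _))

/-- The final linear piece before the zero has nonzero slope, so its length is determined by the
earlier gaps and the first ruin time. -/
lemma gap_mem_of_level_eq_zero {K : Subfield ℝ} (hK : ∀ k x, M.rate k x ∈ K) (k : Fin 2) (n : ℕ)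
    (hR : (tau1 M J).toReal ∈ K) (hgap : ∀ j ≠ n, θ k (j + 1) - θ k j ∈ K)
    (h0 : level M J k (θ k (n + 1)) = 0) : θ k (n + 1) - θ k n ∈ K := by
  have hθ : ∀ j ≤ n, θ k j ∈ K := by
    intro j
    induction j with
    | zero => intro _; rw [h.zero]; exact K.zero_mem
    | succ j ih =>
      intro hj
      have := K.add_mem (hgap j (by omega)) (ih (by omega))
      rwa [sub_add_cancel] at this
  obtain ⟨s, x, y, hs, heq⟩ := h.level_succ k n
  have hsK : s ∈ K := by rcases hs with rfl | rfl; exacts [hθ n le_rfl, hR]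
  have hne := M.rate_ne_zero k y
  rw [h0] at heq
  have : θ k (n + 1) - θ k n = s - θ k n
      - (level M J k (θ k n) + M.rate k x * (s - θ k n)) / M.rate k y := by
    field_simp
    linarith
  rw [this]
  exact K.sub_mem (K.sub_mem hsK (hθ n le_rfl)) (K.div_mem (K.add_mem
    (h.level_arrival_mem hK k hθ hR n le_rfl) (K.mul_mem (hK k x) (K.sub_mem hsK (hθ n le_rfl))))
    (hK k y))

/-- With the other gaps and the ruin time fixed, the zero condition is linear in the first gap, with
coefficient the initial slope minus the slope at ruin. The former is positive and the latter
negative, so it can be solved. -/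
lemma gap_zero_mem_of_level_tau1_eq_zero {K : Subfield ℝ} (hK : ∀ k x, M.rate k x ∈ K)
    (k : Fin 2) (hR : (tau1 M J).toReal ∈ K) (hgap : ∀ j ≠ 0, θ k (j + 1) - θ k j ∈ K)
    (hτ : tau1 M J < ⊤) (h0 : level M J k (tau1 M J).toReal = 0) : θ k 1 - θ k 0 ∈ K := by
  rw [h.zero, sub_zero]
  set R := (tau1 M J).toReal with hRdef
  have hR0 : 0 < R := h.toReal_tau1_pos hτ
  have hdiff : ∀ n, θ k (n + 1) - θ k 1 ∈ K := by
    intro n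
    induction n with
    | zero => rw [zero_add, sub_self]; exact K.zero_mem
    | succ n ih =>
      have := K.add_mem (hgap (n + 1) (by omega)) ih
      rwa [sub_add_sub_cancel] at this
  have hlev : ∀ n, ENNReal.ofReal (θ k (n + 1)) ≤ tau1 M J →
      level M J k (θ k (n + 1)) - M.r k (M.init k) * θ k 1 ∈ K := by
    intro n
    induction n with
    | zero =>
      intro hn
      rw [h.level_eq_init k (h.arrival_nonneg k _) hn (by simp), zero_add, sub_self]
      exact K.zero_mem
    | succ n ih =>
      intro hn
      rw [h.level_succ_of_le k (n + 1) hn, add_sub_right_comm]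
      exact K.add_mem (ih ((ENNReal.ofReal_le_ofReal
        ((h.strictMono k).monotone (n + 1).le_succ)).trans hn))
        (K.mul_mem (hK k _) (hgap (n + 1) (by omega)))
  obtain ⟨n, hn, heq⟩ := h.exists_level_tau1_eq hτ k
  rw [h0] at heq
  have hlt : ENNReal.ofReal (θ k n) < tau1 M J := by
    rw [← ofReal_tau1 hτ]; exact (ENNReal.ofReal_lt_ofReal_iff hR0).2 hn
  rcases n with _ | n
  · rw [h.zero, level_zero, h.init] at heq
    have := mul_pos (M.init_pos k) hR0
    simp only [Params.rate, Sum.elim_inl, sub_zero, zero_add] at heq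
    linarith
  have hpos := h.level_pos_of_lt k (h.arrival_pos k n) hlt
  set c := M.rate k (J k (θ k (n + 1))) with hc
  have hc0 : c < 0 := by
    by_contra! hc0
    have := mul_nonneg hc0 (sub_pos.2 hn).le
    linarith
  have hne : M.r k (M.init k) - c ≠ 0 := by
    have := M.init_pos k
    linarith
  have hrK : M.r k (M.init k) ∈ K := hK k (.inl (M.init k))
  have : θ k 1 = -((level M J k (θ k (n + 1)) - M.r k (M.init k) * θ k 1)
      + c * (R - (θ k (n + 1) - θ k 1))) / (M.r k (M.init k) - c) := by
    field_simp
    linarith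
  rw [this]
  exact K.div_mem (K.neg_mem (K.add_mem (hlev n hlt.le) (K.mul_mem (hK k _)
    (K.sub_mem hR (hdiff n))))) (K.sub_mem hrK (hK k _))

end RegularPath

end Path

/-! ### Quantitative crossings with rational data -/

section Path

variable {E S : Fin 2 → Type*} [∀ k, Fintype (E k)] [∀ k, Fintype (S k)]
  {M : Params E S} {J : ∀ k, ℝ → E k ⊕ S k} {θ : Fin 2 → ℕ → ℝ}

/-- The path `f` crosses zero downwards within `2 * ε` before some time `u`, with margins
controlled by `n`, where `m` is a time scale on which `f` may be small initially. -/
def CrossesNear (f : ℝ → ℝ) (m ε : ℝ) (n : ℕ) : Prop :=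
  1 / (n + 1 : ℝ) ≤ m ∧ ∃ u : ℚ, (0 < u ∧ u ≤ n) ∧ f u ≤ -(1 / (n + 1 : ℝ)) ∧
    ∀ q : ℚ, 0 ≤ q → m / 4 ≤ q → q ≤ u - 2 * ε → 1 / (n + 1 : ℝ) ≤ f q

lemma CrossesNear.mono {f : ℝ → ℝ} {m ε : ℝ} {n n' : ℕ} (h : CrossesNear f m ε n) (hn : n ≤ n') :
    CrossesNear f m ε n' := by
  have hle : 1 / (n' + 1 : ℝ) ≤ 1 / (n + 1 : ℝ) := Nat.one_div_le_one_div hn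
  obtain ⟨hm, u, ⟨hu, hun⟩, hlow, hhigh⟩ := h
  exact ⟨hle.trans hm, u, ⟨hu, hun.trans (by exact_mod_cast hn)⟩, by linarith,
    fun q h0 h1 h2 => hle.trans (hhigh q h0 h1 h2)⟩

namespace RegularPath

variable (h : RegularPath M J θ)
include h

lemma exists_crossesNear (hτ : tau1 M J < ⊤) (hτ2 : tau2 M J < ⊤)
    (hne : level M J (second M J) (tau1 M J).toReal ≠ 0)
    (hθ : ∀ n, level M J (second M J) (θ (second M J) (n + 1)) ≠ 0) {m ε : ℝ} (hm : 0 < m)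
    (hε : 0 < ε) : ∃ n, CrossesNear (level M J (second M J)) m ε n := by
  obtain ⟨T, hRT, hpos, U, hTU, hneg⟩ := h.exists_crossing hτ hτ2 hne hθ
  have hT0 : 0 < T := (h.toReal_tau1_pos hτ).trans hRT
  set F := level M J (second M J) with hF
  obtain ⟨u, hTu, huU⟩ := exists_rat_btwn (lt_min hTU (lt_add_of_pos_right T hε))
  have hFu : F u < 0 := hneg u ⟨hTu, (huU.trans_le (min_le_left _ _)).le⟩
  have huT : (u : ℝ) < T + ε := huU.trans_le (min_le_right _ _)
  have hu0 : (0 : ℝ) < u := hT0.trans hTu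
  -- Since `u < T + ε`, this compact interval ends before the crossing time `T`, and the level
  -- attains a positive minimum on it.
  obtain ⟨c, hc0, hc⟩ : ∃ c > 0, ∀ q ∈ Set.Icc (m / 4) ((u : ℝ) - 2 * ε), c ≤ F q := by
    rcases (Set.Icc (m / 4) ((u : ℝ) - 2 * ε)).eq_empty_or_nonempty with he | hn
    · exact ⟨1, one_pos, fun q hq => by rw [he] at hq; exact hq.elim⟩
    · obtain ⟨x, hx, hmin⟩ := isCompact_Icc.exists_isMinOn hn
        ((h.continuousOn_level (second M J)).mono fun x hx =>
          le_trans (by positivity : (0 : ℝ) ≤ m / 4) hx.1)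
      exact ⟨F x, hpos x ⟨lt_of_lt_of_le (by positivity) hx.1, by linarith [hx.2]⟩,
        fun q hq => hmin hq⟩
  obtain ⟨n₁, hn₁⟩ := exists_nat_one_div_lt (lt_min (lt_min hm (neg_pos.2 hFu)) hc0)
  obtain ⟨n₂, hn₂⟩ := exists_nat_ge (u : ℝ)
  have hle : 1 / ((max n₁ n₂ : ℕ) + 1 : ℝ) ≤ 1 / (n₁ + 1 : ℝ) :=
    Nat.one_div_le_one_div (le_max_left _ _)
  have hlt := hle.trans_lt hn₁
  rw [lt_min_iff, lt_min_iff] at hlt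
  refine ⟨max n₁ n₂, hlt.1.1.le, u, ⟨by exact_mod_cast hu0, ?_⟩, by linarith [hlt.1.2],
    fun q _ h1 h2 => hlt.2.le.trans (hc q ⟨h1, h2⟩)⟩
  have : (u : ℝ) ≤ ((max n₁ n₂ : ℕ) : ℝ) := hn₂.trans (by exact_mod_cast le_max_right _ _)
  exact_mod_cast this

/-- Approximating `t` by rationals from the left respects the bound `v`; the gap between `m / 4` and
`m / 2` leaves room for this. -/
lemma le_level_of_forall_rat (k : Fin 2) {m v c : ℝ} (hm : 0 < m)
    (hq : ∀ q : ℚ, 0 ≤ q → m / 4 ≤ q → (q : ℝ) ≤ v → c ≤ level M J k q) {t : ℝ}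
    (h1 : m / 2 ≤ t) (h2 : t ≤ v) : c ≤ level M J k t := by
  by_contra! hlt
  have hcont : ContinuousAt (level M J k) t :=
    (h.continuousOn_level k).continuousAt (Ici_mem_nhds (by linarith))
  obtain ⟨δ, hδ, hball⟩ := Metric.eventually_nhds_iff.1 (hcont.eventually (gt_mem_nhds hlt))
  obtain ⟨q, hq1, hq2⟩ := exists_rat_btwn (max_lt (by linarith : m / 4 < t)
    (sub_lt_self t hδ))
  have hq3 := (le_max_left _ _).trans_lt hq1
  have hq4 := (le_max_right _ _).trans_lt hq1
  have hq0 : (0 : ℝ) ≤ q := by linarith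
  have := hball (y := q) (by rw [Real.dist_eq, abs_lt]; constructor <;> linarith)
  linarith [hq q (by exact_mod_cast hq0) hq3.le (hq2.le.trans h2)]

end RegularPath

end Path

/-! ### Almost sure properties, measurability and the limit -/

section Fluid

variable {E S : Fin 2 → Type*} [∀ k, Fintype (E k)] [∀ k, Fintype (S k)]
  [∀ k, DecidableEq (E k)] [∀ k, DecidableEq (S k)] {M : Params E S}
  {Ω : Type*} [MeasurableSpace Ω] {P : Measure Ω}
  {θ : Fin 2 → ℕ → Ω → ℝ} {J : ∀ k, ℝ → Ω → E k ⊕ S k}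

lemma IsRuinFluid.ae_regularPath [IsProbabilityMeasure P] (h : IsRuinFluid M P θ J) :
    ∀ᵐ ω ∂P, RegularPath M (fun k t => J k t ω) (fun k n => θ k n ω) := by
  filter_upwards [ae_all_iff.2 fun k => (h.poisson k).ae_strictMono,
    ae_all_iff.2 fun k => (h.poisson k).ae_tendsto M.γ₀_pos] with ω h1 h2
  exact
    { zero := fun k => (h.poisson k).zero ω
      strictMono := h1
      tendsto := h2
      init := fun k => h.init k ω
      before := fun k t ht => h.before k t ω ht
      const := fun k s t hs hst => h.const k s t ω hs hst }

lemma IsRuinFluid.indepFun_arrivals (h : IsRuinFluid M P θ J) {a b : Fin 2} (hab : a ≠ b) :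
    IndepFun (fun ω n => θ a n ω) (fun ω n => θ b n ω) P := by
  obtain ⟨rfl, rfl⟩ | ⟨rfl, rfl⟩ : (a = 0 ∧ b = 1) ∨ (a = 1 ∧ b = 0) := by omega
  · exact h.indep
  · exact h.indep.symm

lemma IsRuinFluid.ae_gap_notMem [IsProbabilityMeasure P] (h : IsRuinFluid M P θ J)
    {a b : Fin 2} (hab : a ≠ b) (n : ℕ) :
    ∀ᵐ ω ∂P, θ b (n + 1) ω - θ b n ω ∉ Subfield.closure
      (Set.range (fun p : (Σ k, E k ⊕ S k) => M.rate p.1 p.2) ∪ Set.range (fun i => θ a i ω) ∪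
        {x | ∃ j ≠ n, x = θ b (j + 1) ω - θ b j ω}) :=
  (h.poisson b).ae_gap_notMem_closure (h.poisson a).measurable (h.indepFun_arrivals hab)
    (fun p : (Σ k, E k ⊕ S k) => M.rate p.1 p.2) n

/-- Almost surely the components are not ruined simultaneously, and the component ruined second is
not at level zero at any of its arrival times. -/
lemma IsRuinFluid.ae_nondegenerate [IsProbabilityMeasure P] (h : IsRuinFluid M P θ J) :
    ∀ᵐ ω ∂P, tau1 M (fun k t => J k t ω) < ⊤ → ∀ a b : Fin 2, a ≠ b →
      level M (fun k t => J k t ω) a (tau1 M (fun k t => J k t ω)).toReal = 0 →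
      level M (fun k t => J k t ω) b (tau1 M (fun k t => J k t ω)).toReal ≠ 0 ∧
      ∀ n, level M (fun k t => J k t ω) b (θ b (n + 1) ω) ≠ 0 := by
  have hall : ∀ᵐ ω ∂P, ∀ a b : Fin 2, a ≠ b → ∀ n, θ b (n + 1) ω - θ b n ω ∉ Subfield.closure
      (Set.range (fun p : (Σ k, E k ⊕ S k) => M.rate p.1 p.2) ∪ Set.range (fun i => θ a i ω) ∪
        {x | ∃ j ≠ n, x = θ b (j + 1) ω - θ b j ω}) := by
    simp only [ae_all_iff]
    exact fun a b hab n => h.ae_gap_notMem hab n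
  filter_upwards [h.ae_regularPath, hall] with ω hreg hgap hτ a b hab h0
  -- The field depends on `n`, as it omits exactly the gap that is to be recovered. It contains the
  -- first ruin time because it contains all arrivals of `a`.
  have hmem : ∀ n, (∀ k x, M.rate k x ∈ Subfield.closure
      (Set.range (fun p : (Σ k, E k ⊕ S k) => M.rate p.1 p.2) ∪ Set.range (fun i => θ a i ω) ∪
        {x | ∃ j ≠ n, x = θ b (j + 1) ω - θ b j ω})) ∧
      (∀ i, θ a i ω ∈ Subfield.closure
      (Set.range (fun p : (Σ k, E k ⊕ S k) => M.rate p.1 p.2) ∪ Set.range (fun i => θ a i ω) ∪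
        {x | ∃ j ≠ n, x = θ b (j + 1) ω - θ b j ω})) ∧
      ∀ j ≠ n, θ b (j + 1) ω - θ b j ω ∈ Subfield.closure
      (Set.range (fun p : (Σ k, E k ⊕ S k) => M.rate p.1 p.2) ∪ Set.range (fun i => θ a i ω) ∪
        {x | ∃ j ≠ n, x = θ b (j + 1) ω - θ b j ω}) := fun n =>
    ⟨fun k x => Subfield.subset_closure (Or.inl (Or.inl ⟨⟨k, x⟩, rfl⟩)),
      fun i => Subfield.subset_closure (Or.inl (Or.inr ⟨i, rfl⟩)),
      fun j hj => Subfield.subset_closure (Or.inr ⟨j, hj, rfl⟩)⟩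
  refine ⟨fun hb => ?_, fun n hn => ?_⟩
  · obtain ⟨h1, h2, h3⟩ := hmem 0
    exact hgap a b hab 0 (hreg.gap_zero_mem_of_level_tau1_eq_zero h1 b
      (hreg.tau1_mem h1 a h2 hτ h0) h3 hτ hb)
  · obtain ⟨h1, h2, h3⟩ := hmem n
    exact hgap a b hab n (hreg.gap_mem_of_level_eq_zero h1 b n
      (hreg.tau1_mem h1 a h2 hτ h0) h3 hn)

lemma IsRuinFluid.measurable_rate (h : IsRuinFluid M P θ J) (k : Fin 2) {t : ℝ} (ht : 0 ≤ t) :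
    Measurable fun ω => M.rate k (J k t ω) := by
  classical
  have heq : (fun ω => M.rate k (J k t ω))
      = fun ω => ∑ x, {ω | J k t ω = x}.indicator (fun _ => M.rate k x) ω := by
    funext ω
    rw [Finset.sum_eq_single (J k t ω) (fun x _ hx => Set.indicator_of_notMem (fun h => hx h.symm) _)
      (fun hx => absurd (Finset.mem_univ _) hx)]
    exact (Set.indicator_of_mem (show ω ∈ {ω' | J k t ω' = J k t ω} from rfl)
      fun _ => M.rate k (J k t ω)).symm
  rw [heq]
  exact Finset.measurable_sum _ fun x _ => measurable_const.indicator (h.measurable k t x ht)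

/-- Paths are regular only almost surely; cutting off outside a measurable set of regular paths
makes the rate jointly measurable, so Fubini applies. -/
lemma IsRuinFluid.measurable_indicator_level (h : IsRuinFluid M P θ J) {G : Set Ω}
    (hG : MeasurableSet G)
    (hreg : ∀ ω ∈ G, RegularPath M (fun k t => J k t ω) (fun k n => θ k n ω)) (k : Fin 2) {t : ℝ}
    (ht : 0 ≤ t) : Measurable (G.indicator fun ω => level M (fun k t => J k t ω) k t) := by
  set f : ℝ → Ω → ℝ := fun s => G.indicator fun ω => M.rate k (J k s ω) with hf
  have hjoint := measurable_uncurry_of_right_locally_const f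
    (fun s hs => (h.measurable_rate k hs).indicator hG) fun ω s hs => by
      by_cases hω : ω ∈ G
      · obtain ⟨u, hu, hc⟩ := (hreg ω hω).right_locally_const k hs
        exact ⟨u, hu, fun x hx => by simp only [hf, Set.indicator_of_mem hω, hc x hx]⟩
      · exact ⟨s + 1, by linarith, fun x _ => by simp only [hf, Set.indicator_of_notMem hω]⟩
  have hint := (hjoint.stronglyMeasurable.integral_prod_left'
    (μ := volume.restrict (Set.Ioc 0 t))).measurable
  convert hint using 1
  funext ω
  by_cases hω : ω ∈ G
  · rw [Set.indicator_of_mem hω, level, intervalIntegral.integral_of_le ht]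
    refine setIntegral_congr_fun measurableSet_Ioc fun x hx => ?_
    simp only [hf, if_pos hx.1.le, Set.indicator_of_mem hω]
  · simp [hf, hω]

lemma measurableSet_crossesNear {f : ℝ → Ω → ℝ} (hf : ∀ t, 0 ≤ t → Measurable (f t)) {m : Ω → ℝ}
    (hm : Measurable m) (ε : ℝ) (n : ℕ) :
    MeasurableSet {ω | CrossesNear (fun t => f t ω) (m ω) ε n} := by
  have hf' : ∀ q : ℚ, 0 ≤ q → Measurable (f q) := fun q hq => hf q (by exact_mod_cast hq)
  refine (measurableSet_le measurable_const hm).inter ?_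
  refine (MeasurableSet.iUnion (f := fun u : ℚ => {ω | (0 < u ∧ u ≤ n) ∧
      f u ω ≤ -(1 / (n + 1 : ℝ)) ∧ ∀ q : ℚ, 0 ≤ q → m ω / 4 ≤ q → q ≤ u - 2 * ε →
        1 / (n + 1 : ℝ) ≤ f q ω}) fun u => ?_).congr (by
        ext ω; simp only [Set.mem_iUnion, Set.mem_ofPred_eq]; rfl)
  by_cases hu : 0 < u ∧ u ≤ n
  swap
  · simp only [hu, false_and]
    exact MeasurableSet.empty
  simp only [hu, true_and]
  refine (measurableSet_le (hf' u hu.1.le) measurable_const).inter ?_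
  refine (MeasurableSet.iInter (f := fun q : ℚ => {ω | 0 ≤ q → m ω / 4 ≤ q → q ≤ u - 2 * ε →
        1 / (n + 1 : ℝ) ≤ f q ω}) fun q => ?_).congr (by
        ext ω; simp only [Set.mem_iInter, Set.mem_ofPred_eq]; rfl)
  by_cases hq : 0 ≤ q ∧ (q : ℝ) ≤ u - 2 * ε
  · refine ((measurableSet_lt (measurable_const (a := (q : ℝ))) (hm.div_const 4)).union
      (measurableSet_le (measurable_const (a := 1 / (n + 1 : ℝ))) (hf' q hq.1))).congr ?_
    ext ω
    simp only [Set.mem_union, Set.mem_ofPred_eq, hq.1, hq.2, true_imp_iff]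
    rw [← not_le, ← imp_iff_not_or]
  · refine MeasurableSet.univ.congr ?_
    ext ω
    simp only [Set.mem_univ, Set.mem_ofPred_eq, true_iff]
    exact fun h1 _ h2 => absurd ⟨h1, h2⟩ hq

/-- The level `n` is fixed first, making `U n` small uniformly in `γ`; then `γ` grows. -/
lemma tendsto_measure_zero_of_subset_union {bad : ℝ → Set Ω} {U : ℕ → Set Ω} {V : ℕ → ℝ → Set Ω}
    (hU : Tendsto (fun n => P (U n)) atTop (𝓝 0))
    (hV : ∀ n, Tendsto (fun γ => P (V n γ)) atTop (𝓝 0))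
    (hsub : ∀ n, ∀ᶠ γ in atTop, bad γ ⊆ U n ∪ V n γ) :
    Tendsto (fun γ => P (bad γ)) atTop (𝓝 0) := by
  rw [ENNReal.tendsto_nhds_zero]
  intro e he
  have he2 : 0 < e / 2 := ENNReal.half_pos he.ne'
  obtain ⟨n, hn⟩ := ((ENNReal.tendsto_nhds_zero.1 hU) (e / 2) he2).exists
  filter_upwards [hsub n, (ENNReal.tendsto_nhds_zero.1 (hV n)) (e / 2) he2] with γ h1 h2
  calc P (bad γ) ≤ P (U n) + P (V n γ) := (measure_mono h1).trans (measure_union_le _ _)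
    _ ≤ e / 2 + e / 2 := add_le_add hn h2
    _ = e := ENNReal.add_halves e

lemma tendsto_measure_iUnion_fin_two {α : Type*} {l : Filter α} {V : Fin 2 → α → Set Ω}
    (hV : ∀ k, Tendsto (fun a => P (V k a)) l (𝓝 0)) :
    Tendsto (fun a => P (⋃ k, V k a)) l (𝓝 0) := by
  have hsum := tendsto_finsetSum (Finset.univ : Finset (Fin 2)) fun k _ => hV k
  rw [Finset.sum_const_zero] at hsum
  exact tendsto_of_tendsto_of_tendsto_of_le_of_le tendsto_const_nhds hsum (fun _ => zero_le)
    fun a => measure_iUnion_fintype_le P _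

lemma tendsto_measure_iUnion_diff [IsFiniteMeasure P] {C : ℕ → Set Ω} (hC : Monotone C)
    (hm : ∀ n, MeasurableSet (C n)) : Tendsto (fun n => P ((⋃ j, C j) \ C n)) atTop (𝓝 0) := by
  have hanti : Antitone fun n => (⋃ j, C j) \ C n := fun i j hij => Set.sdiff_subset_sdiff_right (hC hij)
  have := tendsto_measure_iInter_atTop (μ := P)
    (fun n => ((MeasurableSet.iUnion hm).diff (hm n)).nullMeasurableSet) hanti
    ⟨0, measure_ne_top _ _⟩
  rwa [← Set.sdiff_iUnion, Set.sdiff_self, measure_empty] at this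

/-- Off an event of small probability, all approximations are close to the ruin times. -/
lemma tendsto_measure_approx_far [IsProbabilityMeasure P] (h : IsRuinFluid M P θ J)
    {θh : ℝ → Fin 2 → ℕ → Ω → ℝ}
    (hh : ∀ γ, M.γ₀ < γ → IsExtraGrid P θ J (γ - M.γ₀) (θh γ)) {ε : ℝ} (hε : 0 < ε) :
    Tendsto (fun γ : ℝ => P {ω | ω ∈ ruinEvent M J ∧ ¬
      (max (edist (approxTau1 M (fun k t => J k t ω) (fun k n => θ k n ω) (gridOf θ (θh γ) ω))
          (tau1 M (fun k t => J k t ω)))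
        (edist (approxTau2 M (fun k t => J k t ω) (fun k n => θ k n ω) (gridOf θ (θh γ) ω))
          (tau2 M (fun k t => J k t ω))) ≤ ENNReal.ofReal (3 * ε) ∧
      max (edist ((ellStar M (fun k t => J k t ω) (gridOf θ (θh γ) ω) : ℝ≥0∞) / ENNReal.ofReal γ)
          (tau1 M (fun k t => J k t ω)))
        (edist ((nStar M (fun k t => J k t ω) (fun k n => θ k n ω) (gridOf θ (θh γ) ω) : ℝ≥0∞)
            / ENNReal.ofReal γ)
          (tau2 M (fun k t => J k t ω))) ≤ ENNReal.ofReal (3 * ε))}) atTop (𝓝 0) := by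
  obtain ⟨C, hC0, hC⟩ := M.exists_rate_bound
  obtain ⟨G, hGae, hGm, hG⟩ := (h.ae_regularPath.and h.ae_nondegenerate).exists_measurable_mem
  set F : Fin 2 → ℝ → Ω → ℝ := fun k t =>
    G.indicator fun ω => level M (fun k t => J k t ω) k t with hF
  have hFm : ∀ k t, 0 ≤ t → Measurable (F k t) := fun k t ht =>
    h.measurable_indicator_level hGm (fun ω hω => (hG ω hω).1) k ht
  set m : Ω → ℝ := fun ω => min (θ 0 1 ω) (θ 1 1 ω) with hm
  have hmm : Measurable m := ((h.poisson 0).measurable 1).min ((h.poisson 1).measurable 1)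
  set D : Fin 2 → ℕ → Set Ω := fun b n => {ω | CrossesNear (fun t => F b t ω) (m ω) ε n} with hD
  have hDm : ∀ b n, MeasurableSet (D b n) := fun b n => measurableSet_crossesNear (hFm b) hmm ε n
  have hDmono : ∀ b, Monotone (D b) := fun b i j hij ω hω => 
    CrossesNear.mono (show CrossesNear (fun t => F b t ω) (m ω) ε i from hω) hij
  -- With margin `η = 1 / (n + 1) ≤ m`, this gives `3 * δ ≤ ε`, `6 * δ ≤ m` and the strict `9 * C *
  -- δ < η` together.
  set δ : ℕ → ℝ := fun n => min (ε / 3) (1 / (n + 1 : ℝ) / (9 * C + 6)) with hδ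
  have hδ0 : ∀ n, 0 < δ n := fun n => lt_min (by positivity) (by positivity)
  -- Here the path crosses with some margin but not with margin `1 / (n + 1)`. The union over `b` is
  -- needed because the component ruined second is random.
  set U : ℕ → Set Ω := fun n => Gᶜ ∪ ⋃ b, (⋃ j, D b j) \ D b n with hU
  set V : ℕ → ℝ → Set Ω := fun n γ => ⋃ k, {ω | ¬ GridClose γ (n + 3 * δ n) (δ n)
    (gridOf θ (θh γ) ω k)} with hV
  refine tendsto_measure_zero_of_subset_union (U := U) (V := V) ?_ (fun n => ?_) fun n => ?_
  · have h1 := tendsto_measure_iUnion_fin_two (P := P) (V := fun b n => (⋃ j, D b j) \ D b n)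
      fun b => tendsto_measure_iUnion_diff (hDmono b) (hDm b)
    refine tendsto_of_tendsto_of_tendsto_of_le_of_le tendsto_const_nhds h1 (fun _ => zero_le)
      fun n => (measure_union_le _ _).trans ?_
    rw [show P Gᶜ = 0 from mem_ae_iff.1 hGae, zero_add]
  · exact tendsto_measure_iUnion_fin_two fun k => tendsto_measure_not_gridClose M.γ₀_pos
      (h.poisson k) (fun γ hγ => (hh γ hγ).poisson k) _ (hδ0 n)
  · filter_upwards [eventually_gt_atTop 0, eventually_ge_atTop (1 / δ n)] with γ hγ hγδ ω hω
    rw [div_le_iff₀ (hδ0 n)] at hγδ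
    obtain ⟨⟨hτ, hτ2⟩, hfar⟩ := hω
    by_contra hnot
    have hnotU : ω ∉ U n := fun hx => hnot (Or.inl hx)
    have hnotV : ω ∉ V n γ := fun hx => hnot (Or.inr hx)
    have hωG : ω ∈ G := by
      by_contra hx
      exact hnotU (Or.inl hx)
    obtain ⟨hreg, hnd⟩ := hG ω hωG
    set b := second M (fun k t => J k t ω) with hb
    obtain ⟨hne, hθ⟩ := hnd hτ _ b RegularPath.second_ne_first.symm (hreg.level_first_tau1 hτ)
    have hm0 : 0 < m ω := lt_min (hreg.arrival_pos 0 0) (hreg.arrival_pos 1 0)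
    have hFω : (fun t => F b t ω) = level M (fun k t => J k t ω) b := by
      funext t
      simp only [hF, Set.indicator_of_mem hωG]
    have hωD : ω ∈ D b n := by
      by_contra hx
      obtain ⟨j, hj⟩ := hreg.exists_crossesNear hτ hτ2 hne hθ hm0 hε
      rw [← hFω] at hj
      exact hnotU (Or.inr (Set.mem_iUnion.2 ⟨b, Set.mem_iUnion.2 ⟨j, hj⟩, hx⟩))
    have hcr : CrossesNear (fun t => F b t ω) (m ω) ε n := hωD
    rw [hFω] at hcr
    obtain ⟨hnm, u, ⟨hu0, hun⟩, hlow, hhigh⟩ := hcr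
    have hclose : ∀ k, GridClose γ (n + 3 * δ n) (δ n) (gridOf θ (θh γ) ω k) := fun k => by
      by_contra hx
      exact hnotV (Set.mem_iUnion.2 ⟨k, hx⟩)
    have hun' : (u : ℝ) ≤ n := by exact_mod_cast hun
    have hη : (9 * C + 6) * δ n ≤ 1 / (n + 1 : ℝ) := by
      have : δ n ≤ 1 / (n + 1 : ℝ) / (9 * C + 6) := min_le_right _ _
      rwa [le_div_iff₀ (by positivity), mul_comm] at this
    have hCδ : 0 < C * δ n := mul_pos hC0 (hδ0 n)
    have hδε : δ n ≤ ε / 3 := min_le_left _ _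
    have hδn := hδ0 n
    refine hfar (hreg.edist_approx_le hτ hne hC (m := m ω) (u := u) (η := 1 / (n + 1 : ℝ))
      (fun k => ?_) (by exact_mod_cast hu0) hlow
      (fun q h1 h2 => hreg.le_level_of_forall_rat b hm0 hhigh h1 h2) hγ hγδ (by linarith) hclose
      (fun k j => superpose_nonneg _ _ _) (by linarith) (by linarith) (by linarith))
    obtain rfl | rfl : k = 0 ∨ k = 1 := by omega
    · exact min_le_left _ _
    · exact min_le_right _ _

end Fluid

lemma TendstoInProbOn.of_tendsto_measure_far {Ω : Type*} [MeasurableSpace Ω] {P : Measure Ω}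
    {A : Set Ω} {x : ℝ → Ω → ℝ≥0∞ × ℝ≥0∞} {y : Ω → ℝ≥0∞ × ℝ≥0∞}
    (h : ∀ ε : ℝ, 0 < ε → Tendsto (fun c : ℝ => P {ω | ω ∈ A ∧
      ¬ max (edist (x c ω).1 (y ω).1) (edist (x c ω).2 (y ω).2) ≤ ENNReal.ofReal (3 * ε)})
        atTop (𝓝 0)) : TendstoInProbOn P A x y := by
  intro ε hε
  obtain ⟨e, he0, he1, he2⟩ := ENNReal.lt_iff_exists_real_btwn.1 hε
  have he : 0 < e := ENNReal.ofReal_pos.1 he1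
  refine tendsto_of_tendsto_of_tendsto_of_le_of_le tendsto_const_nhds (h (e / 3) (by positivity))
    (fun _ => zero_le) fun c => measure_mono fun ω hω => ⟨hω.1, fun hle => ?_⟩
  rw [mul_div_cancel₀ e (by norm_num : (3 : ℝ) ≠ 0)] at hle
  exact (hω.2.trans hle).not_gt he2

end RuinFluid

theorem theorem3 {E S : Fin 2 → Type*} [∀ k, Fintype (E k)] [∀ k, Fintype (S k)]
    [∀ k, DecidableEq (E k)] [∀ k, DecidableEq (S k)] (M : RuinFluid.Params E S)
    {Ω : Type*} [MeasurableSpace Ω] (P : Measure Ω) [IsProbabilityMeasure P]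
    (θ : Fin 2 → ℕ → Ω → ℝ) (J : ∀ k, ℝ → Ω → E k ⊕ S k)
    (hJ : RuinFluid.IsRuinFluid M P θ J)
    (θhat : ℝ → Fin 2 → ℕ → Ω → ℝ)
    (hhat : ∀ γ, M.γ₀ < γ → RuinFluid.IsExtraGrid P θ J (γ - M.γ₀) (θhat γ)) :
    RuinFluid.TendstoInProbOn P (RuinFluid.ruinEvent M J)
      (fun γ ω =>
        (RuinFluid.approxTau1 M (fun k t => J k t ω) (fun k n => θ k n ω)
          (RuinFluid.gridOf θ (θhat γ) ω),
        RuinFluid.approxTau2 M (fun k t => J k t ω) (fun k n => θ k n ω)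
          (RuinFluid.gridOf θ (θhat γ) ω)))
      (fun ω => (RuinFluid.tau1 M (fun k t => J k t ω), RuinFluid.tau2 M (fun k t => J k t ω))) ∧
    RuinFluid.TendstoInProbOn P (RuinFluid.ruinEvent M J)
      (fun γ ω =>
        ((RuinFluid.ellStar M (fun k t => J k t ω)
          (RuinFluid.gridOf θ (θhat γ) ω) : ℝ≥0∞) / ENNReal.ofReal γ,
        (RuinFluid.nStar M (fun k t => J k t ω) (fun k n => θ k n ω)
          (RuinFluid.gridOf θ (θhat γ) ω) : ℝ≥0∞) / ENNReal.ofReal γ))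
      (fun ω => (RuinFluid.tau1 M (fun k t => J k t ω), RuinFluid.tau2 M (fun k t => J k t ω))) := by
  constructor
  · refine RuinFluid.TendstoInProbOn.of_tendsto_measure_far fun ε hε =>
      tendsto_of_tendsto_of_tendsto_of_le_of_le tendsto_const_nhds
        (RuinFluid.tendsto_measure_approx_far hJ hhat hε) (fun _ => zero_le) fun γ =>
          measure_mono fun ω hω => ⟨hω.1, fun hle => hω.2 hle.1⟩
  · refine RuinFluid.TendstoInProbOn.of_tendsto_measure_far fun ε hε =>
      tendsto_of_tendsto_of_tendsto_of_le_of_le tendsto_const_nhds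
        (RuinFluid.tendsto_measure_approx_far hJ hhat hε) (fun _ => zero_le) fun γ =>
          measure_mono fun ω hω => ⟨hω.1, fun hle => hω.2 hle.2⟩
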